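/- Let $\mathbb{F}\in\{\mathbb{R},\mathbb{C},\mathbb{H}\}$ and let $1\le m\le n$ be integers. Regard $\mathbb{F}^n$ as a right $\mathbb{F}$-vector space with the euclidean inner product $\langle v,w\rangle=\operatorname{Re}\sum_{i=1}^n\overline{v_i}\,w_i$, on which $n\times n$ matrices act by $x\mapsto Ax$. Let $\operatorname{Gr}_m(n,\mathbb{F})$ be the Grassmannian of $m$-dimensional $\mathbb{F}$-linear subspaces of $\mathbb{F}^n$, and let $dE$ be its unique Borel probability measure that is invariant under $\mathrm{U}(n,\mathbb{F})=\{A : AA^*=I\}$. For a compact convex set $K\subseteq\mathbb{F}^n$ with non-empty interior define the $m$-th affine quermassintegral and the $m$-th dual affine quermassintegral $$\Phi_m^{\mathbb{F}}(K)=\int_{\operatorname{Gr}_m(n,\mathbb{F})}|P_EK|^{-n}\,dE,\qquad \widetilde\Phi_m^{\mathbb{F}}(K)=\int_{\operatorname{Gr}_m(n,\mathbb{F})}|K\cap E|^{n}\,dE,$$ where $P_E\colon\mathbb{F}^n\to E$ is the orthogonal projection and $|\cdot|$ is the Lebesgue measure of the euclidean space $E$. Let $\mathrm{SL}(n,\mathbb{F})$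 be the group of $n\times n$ matrices over $\mathbb{F}$ of determinant $1$, where the determinant for $\mathbb{F}=\mathbb{H}$ is the Dieudonné determinant with values in $\mathbb{H}^\times/[\mathbb{H}^\times,\mathbb{H}^\times]\cup\{0\}$. Then for every compact convex set $K\subseteq\mathbb{F}^n$ with non-empty interior and every $g\in\mathrm{SL}(n,\mathbb{F})$, $$\Phi_m^{\mathbb{F}}(gK)=\Phi_m^{\mathbb{F}}(K)\qquad\text{and}\qquad\widetilde\Phi_m^{\mathbb{F}}(gK)=\widetilde\Phi_m^{\mathbb{F}}(K).$$ -/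

import Mathlib

open MeasureTheory
open scoped Quaternion ENNReal

set_option linter.unusedSectionVars false

noncomputable section

/-! ## Scalars and coordinate spaces

The scalar field `F` is `ℝ`, `ℂ` or `ℍ[ℝ]`.  The general definitions below use only a few properties
which these three have in common.  Vector spaces over `F` are *right* vector spaces, that is, modules
over `Fᵐᵒᵖ`; for `ℝ` and `ℂ` this is the same as a left vector space. -/

/-- The conjugation of `F` satisfies `x̄ x = |x|²`. -/
class StarMulSelf (F : Type) [NormedDivisionRing F] [StarRing F] [InnerProductSpace ℝ F] : Prop where
  star_mul_self : ∀ x : F, star x * x = (‖x‖ ^ 2 : ℝ) • (1 : F)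

instance : StarMulSelf ℝ where
  star_mul_self x := by simp [pow_two]

instance : StarMulSelf ℂ where
  star_mul_self x := by
    rw [Complex.star_def, mul_comm, Complex.mul_conj, Complex.normSq_eq_norm_sq]
    simp

instance : StarMulSelf ℍ[ℝ] where
  star_mul_self x := by
    rw [Quaternion.star_mul_self, Quaternion.normSq_eq_norm_mul_self, pow_two, Algebra.smul_def,
      mul_one]
    rfl

section Quermass

variable (F : Type) [NormedDivisionRing F] [StarRing F] [InnerProductSpace ℝ F]
  [FiniteDimensional ℝ F] [SMulCommClass ℝ F F] [CStarRing F] [StarMulSelf F]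

/-- `F^n` with the norm `‖x‖² = ∑ |x i|²`.  Its real inner product is the real part of the standard
(hyper)hermitian product. -/
abbrev FVec (F : Type) (n : ℕ) : Type := EuclideanSpace F (Fin n)

/-- The (right) `F`-linear map `x ↦ A x` of `F^n` given by a matrix `A`. -/
def matrixAct {F : Type} [NormedDivisionRing F] {n : ℕ} (A : Matrix (Fin n) (Fin n) F) :
    FVec F n →ₗ[Fᵐᵒᵖ] FVec F n where
  toFun x := WithLp.toLp 2 (A.mulVec x.ofLp)
  map_add' x y := by simp [Matrix.mulVec_add]
  map_smul' a x := by simp [Matrix.mulVec_smul]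

/-! ## The unitary group `U(n, F)` -/

/-- The group of all `n × n` matrices `A` over `F` with `A A* = A* A = 1`. -/
def UnitaryGp (n : ℕ) : Type := unitary (Matrix (Fin n) (Fin n) F)

namespace UnitaryGp
variable (n : ℕ)

instance : Group (UnitaryGp F n) := inferInstanceAs (Group (unitary (Matrix (Fin n) (Fin n) F)))

instance : TopologicalSpace (UnitaryGp F n) :=
  inferInstanceAs (TopologicalSpace (unitary (Matrix (Fin n) (Fin n) F)))

instance : IsTopologicalGroup (UnitaryGp F n) :=
  inferInstanceAs (IsTopologicalGroup (unitary (Matrix (Fin n) (Fin n) F)))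

instance : MeasurableSpace (UnitaryGp F n) := borel _

instance : BorelSpace (UnitaryGp F n) := ⟨rfl⟩

variable {F n}

/-- The underlying matrix. -/
def toMatrix (u : UnitaryGp F n) : Matrix (Fin n) (Fin n) F := u.1

lemma star_mul_self (u : UnitaryGp F n) : star u.toMatrix * u.toMatrix = 1 := u.2.1

lemma mul_star_self (u : UnitaryGp F n) : u.toMatrix * star u.toMatrix = 1 := u.2.2

lemma toMatrix_mul (u v : UnitaryGp F n) : (u * v).toMatrix = u.toMatrix * v.toMatrix := rfl

lemma toMatrix_one : (1 : UnitaryGp F n).toMatrix = 1 := rfl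

lemma toMatrix_inv (u : UnitaryGp F n) : (u⁻¹).toMatrix = star u.toMatrix := rfl

lemma continuous_toMatrix : Continuous (toMatrix : UnitaryGp F n → _) := continuous_subtype_val

end UnitaryGp

variable {F} {n m : ℕ}

lemma matrixAct_mul (A B : Matrix (Fin n) (Fin n) F) (x : FVec F n) :
    matrixAct (A * B) x = matrixAct A (matrixAct B x) := by
  simp [matrixAct, Matrix.mulVec_mulVec]

lemma matrixAct_one (x : FVec F n) : matrixAct (1 : Matrix (Fin n) (Fin n) F) x = x := by
  simp [matrixAct]

lemma sum_star_mul_self (x : Fin n → F) :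
    ∑ i, star (x i) * x i = (∑ i, ‖x i‖ ^ 2 : ℝ) • (1 : F) := by
  simp [StarMulSelf.star_mul_self, Finset.sum_smul]

lemma UnitaryGp.norm_matrixAct (u : UnitaryGp F n) (x : FVec F n) :
    ‖matrixAct u.toMatrix x‖ = ‖x‖ := by
  have h1 : ∑ i, star (matrixAct u.toMatrix x i) * matrixAct u.toMatrix x i
      = ∑ i, star (x i) * x i := by
    change star (u.toMatrix.mulVec x.ofLp) ⬝ᵥ (u.toMatrix.mulVec x.ofLp) = star x.ofLp ⬝ᵥ x.ofLp
    rw [Matrix.star_mulVec, ← Matrix.dotProduct_mulVec, Matrix.mulVec_mulVec,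
      ← Matrix.star_eq_conjTranspose, u.star_mul_self, Matrix.one_mulVec]
  rw [sum_star_mul_self, sum_star_mul_self] at h1
  have h2 := smul_left_injective ℝ (one_ne_zero (α := F)) h1
  rw [PiLp.norm_eq_of_L2, PiLp.norm_eq_of_L2, h2]

/-- A unitary matrix acts on `F^n` as an `F`-linear automorphism. -/
def UnitaryGp.equiv (u : UnitaryGp F n) : FVec F n ≃ₗ[Fᵐᵒᵖ] FVec F n :=
  { matrixAct u.toMatrix with
    invFun := matrixAct (u⁻¹).toMatrix
    left_inv := fun x => by
      change matrixAct _ (matrixAct _ x) = x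
      rw [← matrixAct_mul, ← UnitaryGp.toMatrix_mul, inv_mul_cancel, UnitaryGp.toMatrix_one,
        matrixAct_one]
    right_inv := fun x => by
      change matrixAct _ (matrixAct _ x) = x
      rw [← matrixAct_mul, ← UnitaryGp.toMatrix_mul, mul_inv_cancel, UnitaryGp.toMatrix_one,
        matrixAct_one] }

/-- The same automorphism as a real linear isometry. -/
def UnitaryGp.isometry (u : UnitaryGp F n) : FVec F n ≃ₗᵢ[ℝ] FVec F n where
  toLinearEquiv := u.equiv.restrictScalars ℝ
  norm_map' := u.norm_matrixAct

instance : CompactSpace (UnitaryGp F n) := by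
  have : ProperSpace F := FiniteDimensional.proper_real F
  have hbound : ∀ A ∈ unitary (Matrix (Fin n) (Fin n) F), ∀ i j, ‖A i j‖ ≤ 1 := by
    intro A hA i j
    have h1 : (star A * A) j j = 1 := by rw [hA.1]; simp
    rw [Matrix.mul_apply] at h1
    simp only [Matrix.star_apply] at h1
    rw [sum_star_mul_self (fun i => A i j)] at h1
    have h2 : (∑ i, ‖A i j‖ ^ 2 : ℝ) = 1 :=
      smul_left_injective ℝ (one_ne_zero (α := F)) (by simpa using h1)
    have h3 : ‖A i j‖ ^ 2 ≤ 1 := by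
      rw [← h2]
      exact Finset.single_le_sum (f := fun i => ‖A i j‖ ^ 2) (fun _ _ => by positivity)
        (Finset.mem_univ i)
    nlinarith [norm_nonneg (A i j)]
  have hb : IsCompact {A : Matrix (Fin n) (Fin n) F | ∀ i ∈ Set.univ, ∀ j ∈ Set.univ,
      A i j ∈ Metric.closedBall (0 : F) 1} :=
    isCompact_univ_pi fun _ => isCompact_univ_pi fun _ => isCompact_closedBall _ _
  have hc : IsCompact (unitary (Matrix (Fin n) (Fin n) F) : Set (Matrix (Fin n) (Fin n) F)) :=
    hb.of_isClosed_subset isClosed_unitary fun A hA i _ j _ => by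
      rw [mem_closedBall_zero_iff]
      exact hbound A hA i j
  exact isCompact_iff_compactSpace.mp hc

variable (F n) in
/-- The Haar probability measure of the compact group `U(n, F)`. -/
def unitaryHaar : Measure (UnitaryGp F n) := Measure.haarMeasure ⊤

instance : IsProbabilityMeasure (unitaryHaar F n) :=
  ⟨Measure.haarMeasure_self (K₀ := (⊤ : TopologicalSpace.PositiveCompacts (UnitaryGp F n)))⟩

instance : (unitaryHaar F n).IsMulLeftInvariant :=
  inferInstanceAs (Measure.haarMeasure _).IsMulLeftInvariant

/-! ## The Grassmannian `Gr_m(n, F)` -/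

variable (F n m) in
/-- The set of `m`-dimensional `F`-linear subspaces of `F^n`. -/
def Gr : Type := {E : Submodule Fᵐᵒᵖ (FVec F n) // Module.finrank Fᵐᵒᵖ E = m}

namespace Gr

/-- An `F`-linear subspace, regarded as a real linear subspace. -/
def real (E : Gr F n m) : Submodule ℝ (FVec F n) := E.1.restrictScalars ℝ

/-- The topology in which `E` varies continuously if and only if the orthogonal projection onto `E`
does; it is given by the metric `‖P_E - P_E'‖`. -/
instance : TopologicalSpace (Gr F n m) :=
  TopologicalSpace.induced (fun E => E.real.starProjection) inferInstance

instance : MeasurableSpace (Gr F n m) := borel _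

instance : BorelSpace (Gr F n m) := ⟨rfl⟩

/-- The image of a subspace under a unitary matrix. -/
def rotate (u : UnitaryGp F n) (E : Gr F n m) : Gr F n m :=
  ⟨E.1.map (u.equiv : FVec F n →ₗ[Fᵐᵒᵖ] FVec F n), by rw [LinearEquiv.finrank_map_eq, E.2]⟩

lemma rotate_mul (u v : UnitaryGp F n) (E : Gr F n m) : rotate (u * v) E = rotate u (rotate v E) := by
  apply Subtype.ext
  change Submodule.map _ _ = Submodule.map _ (Submodule.map _ _)
  rw [← Submodule.map_comp]
  congr 1
  ext1 x
  exact matrixAct_mul _ _ x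

lemma starProjection_rotate (u : UnitaryGp F n) (E : Gr F n m) (x : FVec F n) :
    (rotate u E).real.starProjection x
      = matrixAct u.toMatrix (E.real.starProjection (matrixAct (u⁻¹).toMatrix x)) := by
  have h := Submodule.starProjection_map_apply u.isometry E.real x
  exact h

lemma continuous_matrixAct : Continuous fun p : Matrix (Fin n) (Fin n) F × FVec F n =>
    matrixAct p.1 p.2 := by
  change Continuous fun p : Matrix (Fin n) (Fin n) F × FVec F n =>
    WithLp.toLp 2 (p.1.mulVec p.2.ofLp)
  fun_prop

lemma continuous_rotate (E : Gr F n m) : Continuous fun u : UnitaryGp F n => rotate u E := by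
  refine continuous_induced_rng.mpr (continuous_clm_apply.mpr fun x => ?_)
  simp only [Function.comp_def, starProjection_rotate]
  have h1 : Continuous fun u : UnitaryGp F n => matrixAct (u⁻¹).toMatrix x :=
    continuous_matrixAct.comp
      ((UnitaryGp.continuous_toMatrix.comp continuous_inv).prodMk continuous_const)
  exact continuous_matrixAct.comp
    (UnitaryGp.continuous_toMatrix.prodMk (E.real.starProjection.continuous.comp h1))

lemma continuous_rotate_right (u : UnitaryGp F n) :
    Continuous fun E : Gr F n m => rotate u E := by
  refine continuous_induced_rng.mpr (continuous_clm_apply.mpr fun x => ?_)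
  simp only [Function.comp_def, starProjection_rotate]
  have h1 : Continuous fun E : Gr F n m => E.real.starProjection := continuous_induced_dom
  exact continuous_matrixAct.comp
    (continuous_const.prodMk (continuous_clm_apply.mp h1 (matrixAct (u⁻¹).toMatrix x)))

variable (F n m) in
/-- The subspace of all `x` whose coordinates vanish except possibly the first `m` ones. -/
def coordSubspace : Submodule Fᵐᵒᵖ (FVec F n) where
  carrier := {x | ∀ i : Fin n, m ≤ i → x i = 0}
  add_mem' := fun {x y} hx hy i hi => by simp [hx i hi, hy i hi]
  zero_mem' := fun _ _ => rfl
  smul_mem' := fun a x hx i hi => by simp [hx i hi]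

/-- It is isomorphic to `F^m`. -/
def coordEquiv (h : m ≤ n) : coordSubspace F n m ≃ₗ[Fᵐᵒᵖ] (Fin m → F) where
  toFun x i := x.1 (Fin.castLE h i)
  map_add' _ _ := rfl
  map_smul' _ _ := rfl
  invFun y := ⟨WithLp.toLp 2 fun i => if hi : (i : ℕ) < m then y ⟨i, hi⟩ else 0,
    fun i hi => by simp [hi]⟩
  left_inv x := by
    ext i
    by_cases hi : (i : ℕ) < m
    · simp [hi]
    · simpa [hi] using (x.2 i (not_lt.mp hi)).symm
  right_inv y := by
    ext i
    simp

lemma finrank_op : Module.finrank Fᵐᵒᵖ F = 1 :=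
  finrank_eq_one (1 : F) one_ne_zero fun w => ⟨MulOpposite.op w, by simp⟩

lemma finrank_coordSubspace (h : m ≤ n) : Module.finrank Fᵐᵒᵖ (coordSubspace F n m) = m := by
  have : Module.Finite Fᵐᵒᵖ F := Module.finite_of_finrank_eq_succ finrank_op
  rw [(coordEquiv h).finrank_eq, Module.finrank_pi_fintype]
  simp [finrank_op]

variable (F) in
/-- The base point of the Grassmannian. -/
def base (h : m ≤ n) : Gr F n m := ⟨coordSubspace F n m, finrank_coordSubspace h⟩

variable (F) in
/-- The Haar probability measure of the Grassmannian: the distribution of `u E₀` for a random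
`u ∈ U(n, F)`, where `E₀` is the base point.  It is the unique `U(n, F)`-invariant Borel probability
measure, since `U(n, F)` acts transitively; in particular the choice of `E₀` does not matter. -/
def haar (h : m ≤ n) : Measure (Gr F n m) :=
  (unitaryHaar F n).map fun u => rotate u (base F h)

instance (h : m ≤ n) : IsProbabilityMeasure (haar F h) :=
  Measure.isProbabilityMeasure_map (continuous_rotate _).measurable.aemeasurable

/-- It is invariant under the unitary group. -/
lemma map_rotate_haar (h : m ≤ n) (u : UnitaryGp F n) :
    (haar F h).map (rotate u) = haar F h := by
  rw [haar, Measure.map_map (continuous_rotate_right u).measurable (continuous_rotate _).measurable]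
  nth_rewrite 2 [← map_mul_left_eq_self (unitaryHaar F n) u]
  rw [Measure.map_map (continuous_rotate _).measurable (measurable_const_mul u)]
  congr 1
  ext1 v
  exact (rotate_mul u v _).symm

end Gr

/-! ## Affine quermassintegrals -/

/-- The Lebesgue measure of a subspace of a euclidean space, with its induced inner product. -/
def subspaceVolume {V : Type} [NormedAddCommGroup V] [InnerProductSpace ℝ V]
    [FiniteDimensional ℝ V] (W : Submodule ℝ V) (S : Set W) : ℝ≥0∞ :=
  letI : MeasurableSpace W := borel W
  haveI : BorelSpace W := ⟨rfl⟩
  (measureSpaceOfInnerProductSpace (E := W)).volume S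

/-- The volume `|P_E K|` of the orthogonal projection of `K` onto `E`. -/
def projVolume (K : Set (FVec F n)) (E : Gr F n m) : ℝ≥0∞ :=
  subspaceVolume E.real (E.real.orthogonalProjectionOnto '' K)

/-- The volume `|K ∩ E|` in `E` of the section of `K` by `E`. -/
def sectionVolume (K : Set (FVec F n)) (E : Gr F n m) : ℝ≥0∞ :=
  subspaceVolume E.real {x : E.real | (x : FVec F n) ∈ K}

/-- The `m`-th affine quermassintegral `∫ |P_E K|⁻ⁿ dE`. -/
def affineQuermassintegral (h : m ≤ n) (K : Set (FVec F n)) : ℝ≥0∞ :=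
  ∫⁻ E : Gr F n m, (projVolume K E ^ n)⁻¹ ∂(Gr.haar F h)

/-- The `m`-th dual affine quermassintegral `∫ |K ∩ E|ⁿ dE`. -/
def dualAffineQuermassintegral (h : m ≤ n) (K : Set (FVec F n)) : ℝ≥0∞ :=
  ∫⁻ E : Gr F n m, sectionVolume K E ^ n ∂(Gr.haar F h)

end Quermass

/-! ## The Dieudonné determinant -/

section Dieudonne

variable {k : Type} [DivisionRing k]

/-- The class `[a]` of `a` in `kˣ / [kˣ, kˣ]`, with `[0] = 0`. -/
def dieudonneClass (a : k) : WithZero (Abelianization kˣ) :=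
  open scoped Classical in
  if h : a = 0 then 0 else ((Abelianization.of (Units.mk0 a h) : Abelianization kˣ) : WithZero _)

/-- The Dieudonné determinant, computed by row elimination.  If the first column vanishes, then the
determinant is `0`.  Otherwise a row `i` with `A i 0 ≠ 0` is moved to the top, which contributes the
factor `[(-1)^i]`, and left multiples of it are subtracted from the other rows to clear the first
column. -/
def dieudonneDet : (n : ℕ) → Matrix (Fin n) (Fin n) k → WithZero (Abelianization kˣ)
  | 0, _ => 1
  | n + 1, A =>
    open scoped Classical in
    if h : ∃ i, A i 0 ≠ 0 then
      dieudonneClass ((-1) ^ (h.choose : ℕ) * A h.choose 0) *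
        dieudonneDet n (Matrix.of fun r c =>
          A (h.choose.succAbove r) c.succ
            - A (h.choose.succAbove r) 0 * (A h.choose 0)⁻¹ * A h.choose c.succ)
    else 0

/-- Over a commutative field it is the ordinary determinant. -/
theorem dieudonneDet_eq_det {k : Type} [Field k] (n : ℕ) (A : Matrix (Fin n) (Fin n) k) :
    dieudonneDet n A = dieudonneClass A.det := by
  have hmul (a b : k) : dieudonneClass a * dieudonneClass b = dieudonneClass (a * b) := by
    by_cases ha : a = 0
    · simp [dieudonneClass, ha]
    by_cases hb : b = 0
    · simp [dieudonneClass, hb]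
    simp only [dieudonneClass, ha, hb, mul_eq_zero, or_self, dite_false, ← WithZero.coe_mul,
      ← map_mul]
    congr 2
    ext
    simp
  induction n with
  | zero =>
    simp only [dieudonneDet, Matrix.det_isEmpty, dieudonneClass, one_ne_zero, dite_false,
      Units.mk0_one, map_one, WithZero.coe_one]
  | succ n ih =>
    rw [dieudonneDet]
    split_ifs with h
    · rw [ih, hmul]
      congr 1
      set i := h.choose
      have hi : A i 0 ≠ 0 := h.choose_spec
      let B : Matrix (Fin (n + 1)) (Fin (n + 1)) k := Matrix.of fun r c =>
        if r = i then A i c else A r c - A r 0 * (A i 0)⁻¹ * A i c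
      have hB : A.det = B.det := by
        refine Matrix.det_eq_of_forall_row_eq_smul_add_const
          (fun r => if r = i then 0 else A r 0 * (A i 0)⁻¹) i (by simp) fun r c => ?_
        by_cases hr : r = i <;> simp [B, hr]
      rw [hB, Matrix.det_succ_column_zero, Finset.sum_eq_single i]
      · congr 1
        · simp [B]
        · congr 1
          ext r c
          simp [B, Fin.succAbove_ne]
      · intro r _ hr
        simp [B, hr, hi]
      · simp
    · push Not at h
      rw [Matrix.det_eq_zero_of_column_eq_zero 0 h]
      simp [dieudonneClass]

end Dieudonne

/-- The quaternionic special linear group `SL(n, ℍ)`. -/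
def quaternionicSL (n : ℕ) : Set (Matrix (Fin n) (Fin n) ℍ[ℝ]) := {A | dieudonneDet n A = 1}

end

/-! Write a subspace `E` as the range of a full-rank `n × m` matrix `X`, and let `jac` be the factor
by which a matrix scales real volume. When `X` is an isometry onto `E`, `|K ∩ E|^n` equals
`|X⁻¹K|^n` and `|P_E K|^{-n}` equals `|X*K|^{-n}`. Both expressions make sense for every `X`, and
under `X ↦ XA` with `A` in `GL(m, F)` both are multiplied by `jac(A)^{-n}` (`IsDensity`). Replacing
`K` by `gK` replaces `X` by `g⁻¹X` in the first and by `g*X` in the second. It therefore suffices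
that the integral of a density `h` over the Grassmannian is unchanged under `X ↦ gX` when `jac g =
1` (`lintegral_unitary_comp_mul_left`).

The degree `-n` is the right one because `X ↦ XA` scales Lebesgue measure `μ` on `n × m` matrices by
`jac(A)^n`. So `h dμ` is invariant under `GL(m, F)`, and `∫ h w dμ` depends on a weight `w` only
through its integrals over the `GL(m, F)`-orbits. For the weight `ballWeight` these orbit integrals
are one constant, finite and nonzero, so `w` and `w(g ·)` give the same result
(`lintegral_exchange`, `lintegral_ballWeight_comp`). Unitary invariance of `w` identifies `∫ h w dμ`
with a fixed multiple of the Grassmannian integral (`lintegral_ballWeight_eq`). The substitution `X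
↦ gX` preserves `μ` since `jac g = 1`, and the two facts combine.

It remains that determinant one forces `jac g = 1`. Row elimination computes both quantities:
splitting off a pivot multiplies `jac` by the volume factor of the pivot, which depends only on its
class modulo commutators (`jac_eq_classJac_dieudonneDet`). -/

set_option linter.unusedSectionVars false

noncomputable section

/-! ### Matrices over `F` as real linear maps: adjoints, Jacobians, multiplication operators. -/

section RealAction

variable {F : Type} [NormedDivisionRing F] [StarRing F] [InnerProductSpace ℝ F]
  [FiniteDimensional ℝ F] [SMulCommClass ℝ F F] [CStarRing F] [StarMulSelf F]
  [IsScalarTower ℝ F F] [StarModule ℝ F]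

variable {n m l : ℕ}

/-- The real linear map `x ↦ X x` given by a rectangular matrix over `F`. -/
def realAct (X : Matrix (Fin n) (Fin m) F) : FVec F m →ₗ[ℝ] FVec F n where
  toFun x := WithLp.toLp 2 (X.mulVec x.ofLp)
  map_add' x y := by simp [Matrix.mulVec_add]
  map_smul' a x := by simp [Matrix.mulVec_smul]

lemma realAct_apply (X : Matrix (Fin n) (Fin m) F) (x : FVec F m) (i : Fin n) :
    realAct X x i = ∑ j, X i j * x j := rfl

lemma realAct_mul (X : Matrix (Fin n) (Fin m) F) (Y : Matrix (Fin m) (Fin l) F) :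
    realAct (X * Y) = realAct X ∘ₗ realAct Y := by
  ext1 x
  simp [realAct, Matrix.mulVec_mulVec]

lemma realAct_one : realAct (1 : Matrix (Fin n) (Fin n) F) = LinearMap.id := by
  ext1 x
  simp [realAct]

lemma realAct_single (X : Matrix (Fin n) (Fin m) F) (i : Fin n) (j : Fin m) :
    realAct X (WithLp.toLp 2 (Pi.single j 1)) i = X i j := by
  simp [realAct]

lemma realAct_injective :
    Function.Injective (realAct : Matrix (Fin n) (Fin m) F → _) := by
  intro X Y h
  ext i j
  rw [← realAct_single X, h, realAct_single]

variable (F n m) in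
/-- `realAct` as a real linear map into the continuous linear maps. -/
def realActCLM : Matrix (Fin n) (Fin m) F →ₗ[ℝ] FVec F m →L[ℝ] FVec F n where
  toFun X := LinearMap.toContinuousLinearMap (realAct X)
  map_add' X Y := by
    ext x i
    simp [realAct, Matrix.add_mulVec]
  map_smul' a X := by
    ext x i
    simp [realAct, Matrix.smul_mulVec]

lemma continuous_realActCLM : Continuous (realActCLM F n m) :=
  LinearMap.continuous_of_finiteDimensional _

lemma continuous_realAct_prod :
    Continuous fun p : Matrix (Fin n) (Fin m) F × FVec F m => realAct p.1 p.2 := by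
  have h : Continuous fun p : Matrix (Fin n) (Fin m) F × FVec F m => realActCLM F n m p.1 p.2 :=
    (continuous_realActCLM.comp continuous_fst).clm_apply continuous_snd
  exact h

/-! ### The adjoint -/

/-- Polarisation of `StarMulSelf.star_mul_self`. The symmetrised product is a real multiple of `1`,
so the real inner product can be read off from `F`-valued products without commutativity. -/
lemma star_mul_add_star_mul (x y : F) :
    star x * y + star y * x = (2 * inner ℝ x y : ℝ) • (1 : F) := by
  have h := StarMulSelf.star_mul_self (x + y)
  rw [norm_add_sq_real, add_smul, add_smul, ← StarMulSelf.star_mul_self x,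
    ← StarMulSelf.star_mul_self y, star_add] at h
  have h' : star x * y + star y * x + (star x * x + star y * y)
      = (2 * inner ℝ x y : ℝ) • (1 : F) + (star x * x + star y * y) := by
    calc _ = (star x + star y) * (x + y) := by noncomm_ring
      _ = _ := by rw [h]; abel
  exact add_right_cancel h'

lemma star_dotProduct_add (x y : FVec F n) :
    star x.ofLp ⬝ᵥ y.ofLp + star y.ofLp ⬝ᵥ x.ofLp = (2 * inner ℝ x y : ℝ) • (1 : F) := by
  simp only [dotProduct, Pi.star_apply, ← Finset.sum_add_distrib, star_mul_add_star_mul,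
    PiLp.inner_apply, Finset.mul_sum, Finset.sum_smul]

/-- The `F`-valued product moves `X` across by associativity alone; symmetrising and comparing
coefficients of `1` transfers this to the real inner product. -/
lemma inner_realAct (X : Matrix (Fin n) (Fin m) F) (x : FVec F m) (y : FVec F n) :
    inner ℝ (realAct X x) y = inner ℝ x (realAct X.conjTranspose y) := by
  have h : (2 * inner ℝ (realAct X x) y : ℝ) • (1 : F)
      = (2 * inner ℝ x (realAct X.conjTranspose y) : ℝ) • (1 : F) := by
    rw [← star_dotProduct_add, ← star_dotProduct_add]
    change star (X.mulVec x.ofLp) ⬝ᵥ y.ofLp + star y.ofLp ⬝ᵥ X.mulVec x.ofLp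
      = star x.ofLp ⬝ᵥ X.conjTranspose.mulVec y.ofLp
        + star (X.conjTranspose.mulVec y.ofLp) ⬝ᵥ x.ofLp
    rw [Matrix.star_mulVec, Matrix.star_mulVec, Matrix.conjTranspose_conjTranspose,
      Matrix.dotProduct_mulVec, Matrix.dotProduct_mulVec]
  have := smul_left_injective ℝ (one_ne_zero (α := F)) h
  linarith

lemma adjoint_realAct (X : Matrix (Fin n) (Fin m) F) :
    LinearMap.adjoint (realAct X) = realAct X.conjTranspose := by
  symm
  rw [LinearMap.eq_adjoint_iff]
  intro x y
  rw [inner_realAct, Matrix.conjTranspose_conjTranspose]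

/-! ### The real Jacobian of a matrix -/

/-- The factor by which `x ↦ X x` multiplies volumes. -/
def jac (X : Matrix (Fin n) (Fin m) F) : ℝ := (realAct X).normDet

lemma jac_nonneg (X : Matrix (Fin n) (Fin m) F) : 0 ≤ jac X := LinearMap.normDet_nonneg _

lemma jac_sq (X : Matrix (Fin n) (Fin m) F) :
    jac X ^ 2 = LinearMap.det (realAct (X.conjTranspose * X)) := by
  have h := LinearMap.normDet_sq (realAct X)
  rw [adjoint_realAct, ← realAct_mul] at h
  exact h

lemma jac_eq_abs_det (A : Matrix (Fin n) (Fin n) F) : jac A = |LinearMap.det (realAct A)| :=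
  LinearMap.normDet_eq_norm_det _

lemma jac_ne_zero_iff {X : Matrix (Fin n) (Fin m) F} :
    jac X ≠ 0 ↔ Function.Injective (realAct X) :=
  (LinearMap.normDet_ne_zero_tfae (realAct X)).out 0 4

lemma jac_mul_jac (A B : Matrix (Fin n) (Fin n) F) : jac (A * B) = jac A * jac B := by
  rw [jac_eq_abs_det, jac_eq_abs_det, jac_eq_abs_det, realAct_mul, LinearMap.det_comp, abs_mul]

lemma jac_one : jac (1 : Matrix (Fin n) (Fin n) F) = 1 := by
  rw [jac_eq_abs_det, realAct_one, LinearMap.det_id, abs_one]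

lemma jac_conjTranspose (A : Matrix (Fin n) (Fin n) F) : jac A.conjTranspose = jac A := by
  rw [jac_eq_abs_det, jac_eq_abs_det, ← adjoint_realAct]
  let b := stdOrthonormalBasis ℝ (FVec F n)
  rw [← LinearMap.det_toMatrix b.toBasis, ← LinearMap.det_toMatrix b.toBasis,
    LinearMap.toMatrix_adjoint, Matrix.det_conjTranspose]
  simp

/-- For rectangular `X` the square of `jac` is the real determinant of the Gram matrix, and the Gram
matrix of `XA` is `A*(X*X)A`, a product of square matrices. -/
lemma jac_mul (X : Matrix (Fin n) (Fin m) F) (A : Matrix (Fin m) (Fin m) F) :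
    jac (X * A) = jac X * jac A := by
  rw [← sq_eq_sq₀ (jac_nonneg _) (mul_nonneg (jac_nonneg _) (jac_nonneg _)), mul_pow, jac_sq X,
    jac_sq, Matrix.conjTranspose_mul, Matrix.mul_assoc, ← Matrix.mul_assoc X.conjTranspose,
    realAct_mul, realAct_mul, LinearMap.det_comp, LinearMap.det_comp, mul_left_comm,
    ← LinearMap.det_comp, ← realAct_mul, ← jac_sq A]

lemma jac_isometry_mul {Y : Matrix (Fin l) (Fin n) F} (hY : Y.conjTranspose * Y = 1)
    (X : Matrix (Fin n) (Fin m) F) : jac (Y * X) = jac X := by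
  rw [← sq_eq_sq₀ (jac_nonneg _) (jac_nonneg _), jac_sq, jac_sq, Matrix.conjTranspose_mul,
    Matrix.mul_assoc, ← Matrix.mul_assoc _ Y, hY, Matrix.one_mul]

lemma norm_realAct_of_isometry {Y : Matrix (Fin n) (Fin m) F} (hY : Y.conjTranspose * Y = 1)
    (x : FVec F m) : ‖realAct Y x‖ = ‖x‖ := by
  rw [← sq_eq_sq₀ (norm_nonneg _) (norm_nonneg _), ← real_inner_self_eq_norm_sq,
    ← real_inner_self_eq_norm_sq, inner_realAct, ← LinearMap.comp_apply, ← realAct_mul, hY,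
    realAct_one, LinearMap.id_apply]

lemma continuous_jac : Continuous (jac : Matrix (Fin n) (Fin m) F → ℝ) := by
  have h : (jac : Matrix (Fin n) (Fin m) F → ℝ)
      = fun X => √((realActCLM F m m (X.conjTranspose * X)).det) := by
    ext X
    rw [← Real.sqrt_sq (jac_nonneg X), jac_sq]
    rfl
  rw [h]
  exact (ContinuousLinearMap.continuous_det.comp (continuous_realActCLM.comp
    (continuous_id.matrix_conjTranspose.matrix_mul continuous_id))).sqrt

/-- Left multiplication by `A` is an injective real endomorphism of the matrix space, hence hits
`1`. This produces an inverse over `F` without a determinant over `F`. -/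
lemma exists_inverse_of_jac_ne_zero {A : Matrix (Fin n) (Fin n) F} (hA : jac A ≠ 0) :
    ∃ B, A * B = 1 ∧ B * A = 1 := by
  have hinj := jac_ne_zero_iff.mp hA
  let f : Matrix (Fin n) (Fin n) F →ₗ[ℝ] Matrix (Fin n) (Fin n) F :=
    { toFun := fun B => A * B
      map_add' := fun B C => Matrix.mul_add _ _ _
      map_smul' := fun r B => Matrix.mul_smul _ _ _ }
  have hf : Function.Injective f := by
    intro B C h
    apply realAct_injective
    ext1 x
    apply hinj
    have h' : realAct (A * B) x = realAct (A * C) x := congrArg (fun M => realAct M x) h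
    simpa only [realAct_mul, LinearMap.comp_apply] using h'
  obtain ⟨B, hB⟩ := LinearMap.surjective_of_injective hf 1
  have hB' : A * B = 1 := hB
  exact ⟨B, hB', mul_eq_one_comm.mp hB'⟩

lemma jac_ne_zero_of_mul_eq_one {A B : Matrix (Fin n) (Fin n) F} (h : A * B = 1) : jac A ≠ 0 := by
  intro h0
  have := jac_mul_jac A B
  rw [h, jac_one, h0, zero_mul] at this
  exact one_ne_zero this

lemma jac_ne_zero_iff_isUnit {A : Matrix (Fin n) (Fin n) F} : jac A ≠ 0 ↔ IsUnit A := by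
  refine ⟨fun h => ?_, fun ⟨u, hu⟩ => hu ▸ jac_ne_zero_of_mul_eq_one u.mul_inv⟩
  obtain ⟨B, h1, h2⟩ := exists_inverse_of_jac_ne_zero h
  exact ⟨⟨A, B, h1, h2⟩, rfl⟩

lemma jac_mul_left_ne_zero {A : Matrix (Fin n) (Fin n) F} (hA : jac A ≠ 0)
    {X : Matrix (Fin n) (Fin m) F} : jac (A * X) ≠ 0 ↔ jac X ≠ 0 := by
  rw [jac_ne_zero_iff, jac_ne_zero_iff, realAct_mul, LinearMap.coe_comp]
  exact (jac_ne_zero_iff.mp hA).of_comp_iff _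

/-! ### Left and right multiplication -/

variable (m) in
/-- Left multiplication by a square matrix, as a real linear map. -/
def mulLeftLin (A : Matrix (Fin n) (Fin n) F) :
    Matrix (Fin n) (Fin m) F →ₗ[ℝ] Matrix (Fin n) (Fin m) F where
  toFun X := A * X
  map_add' _ _ := Matrix.mul_add _ _ _
  map_smul' _ _ := Matrix.mul_smul _ _ _

variable (n) in
/-- Right multiplication by a square matrix, as a real linear map. -/
def mulRightLin (A : Matrix (Fin m) (Fin m) F) :
    Matrix (Fin n) (Fin m) F →ₗ[ℝ] Matrix (Fin n) (Fin m) F where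
  toFun X := X * A
  map_add' _ _ := Matrix.add_mul _ _ _
  map_smul' _ _ := Matrix.smul_mul _ _ _

variable (F n m) in
/-- A matrix as the tuple of its columns. -/
def columnsEquiv : Matrix (Fin n) (Fin m) F ≃ₗ[ℝ] (Fin m → FVec F n) where
  toFun X j := WithLp.toLp 2 fun i => X i j
  invFun v := Matrix.of fun i j => v j i
  map_add' _ _ := rfl
  map_smul' _ _ := rfl
  left_inv _ := rfl
  right_inv _ := rfl

variable (F n m) in
/-- The conjugate transpose as a real linear equivalence. -/
def conjTransposeLin : Matrix (Fin n) (Fin m) F ≃ₗ[ℝ] Matrix (Fin m) (Fin n) F where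
  toFun X := X.conjTranspose
  invFun X := X.conjTranspose
  map_add' _ _ := Matrix.conjTranspose_add _ _
  map_smul' r X := by
    ext i j
    simp
  left_inv _ := Matrix.conjTranspose_conjTranspose _
  right_inv _ := Matrix.conjTranspose_conjTranspose _

/-- `A` acts separately on each of the `m` columns. -/
lemma abs_det_mulLeftLin (A : Matrix (Fin n) (Fin n) F) :
    |LinearMap.det (mulLeftLin m A)| = jac A ^ m := by
  have h : (columnsEquiv F n m : _ →ₗ[ℝ] _) ∘ₗ mulLeftLin m A ∘ₗ
      ((columnsEquiv F n m).symm : _ →ₗ[ℝ] _)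
      = LinearMap.pi fun j : Fin m => realAct A ∘ₗ LinearMap.proj j := by
    ext1 v
    rfl
  rw [← LinearMap.det_conj _ (columnsEquiv F n m), h, LinearMap.det_pi, Finset.prod_const,
    Finset.card_univ, Fintype.card_fin, abs_pow, jac_eq_abs_det]

/-- Conjugate transposition turns right multiplication by `A` into left multiplication by `A*` on
matrices with `n` columns. -/
lemma abs_det_mulRightLin (A : Matrix (Fin m) (Fin m) F) :
    |LinearMap.det (mulRightLin n A)| = jac A ^ n := by
  have h : (conjTransposeLin F n m : _ →ₗ[ℝ] _) ∘ₗ mulRightLin n A ∘ₗ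
      ((conjTransposeLin F n m).symm : _ →ₗ[ℝ] _) = mulLeftLin n A.conjTranspose := by
    ext1 X
    change (X.conjTranspose * A).conjTranspose = A.conjTranspose * X
    rw [Matrix.conjTranspose_mul, Matrix.conjTranspose_conjTranspose]
  rw [← LinearMap.det_conj _ (conjTransposeLin F n m), h, abs_det_mulLeftLin, jac_conjTranspose]

end RealAction

/-! ### Orthonormal frames and transitivity of the unitary group on the Grassmannian. -/

section Transitivity

variable {F : Type} [NormedDivisionRing F] [StarRing F] [InnerProductSpace ℝ F]
  [FiniteDimensional ℝ F] [SMulCommClass ℝ F F] [CStarRing F] [StarMulSelf F]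

variable {n m : ℕ}

variable (F) in
lemma finite_op : Module.Finite Fᵐᵒᵖ F := Module.finite_of_finrank_eq_succ Gr.finrank_op

variable (F n) in
lemma finite_op_FVec : Module.Finite Fᵐᵒᵖ (FVec F n) := by
  have := finite_op F
  exact Module.Finite.equiv (WithLp.linearEquiv 2 Fᵐᵒᵖ (Fin n → F)).symm

variable (F n) in
lemma finrank_op_pi : Module.finrank Fᵐᵒᵖ (Fin n → F) = n := by
  have := finite_op F
  rw [Module.finrank_pi_fintype]
  simp [Gr.finrank_op]

variable (F n) in
lemma finrank_op_FVec : Module.finrank Fᵐᵒᵖ (FVec F n) = n := by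
  rw [(WithLp.linearEquiv 2 Fᵐᵒᵖ (Fin n → F)).finrank_eq, finrank_op_pi]

/-- The (hyper)hermitian product with values in `F`. -/
def hermitian (x y : FVec F n) : F := star x.ofLp ⬝ᵥ y.ofLp

lemma hermitian_self (x : FVec F n) : hermitian x x = (‖x‖ ^ 2 : ℝ) • (1 : F) := by
  rw [PiLp.norm_eq_of_L2, Real.sq_sqrt (by positivity)]
  exact sum_star_mul_self x.ofLp

lemma star_hermitian (x y : FVec F n) : star (hermitian x y) = hermitian y x := by
  simp [hermitian, dotProduct]

/-- Orthogonality to `k` vectors imposes `k` right-linear conditions, which have a nonzero common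
solution in a space of dimension above `k`; a real rescaling normalises it. -/
lemma exists_unit_orthogonal {k : ℕ} (E : Submodule Fᵐᵒᵖ (FVec F n))
    (hk : k < Module.finrank Fᵐᵒᵖ E) (w : Fin k → FVec F n) :
    ∃ x ∈ E, hermitian x x = 1 ∧ ∀ i, hermitian (w i) x = 0 := by
  have := finite_op F
  have := finite_op_FVec F n
  let T : E →ₗ[Fᵐᵒᵖ] (Fin k → F) :=
    { toFun := fun x i => hermitian (w i) x
      map_add' := fun x y => by
        ext i
        simp [hermitian, dotProduct_add]
      map_smul' := fun a x => by
        ext i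
        simp [hermitian, dotProduct_smul] }
  have hT : LinearMap.ker T ≠ ⊥ := by
    apply LinearMap.ker_ne_bot_of_finrank_lt
    rwa [finrank_op_pi]
  obtain ⟨y, hy, hy0⟩ := Submodule.exists_mem_ne_zero_of_ne_bot hT
  have hy1 : ‖(y : FVec F n)‖ ≠ 0 := by simpa using hy0
  refine ⟨‖(y : FVec F n)‖⁻¹ • (y : FVec F n), (E.restrictScalars ℝ).smul_mem _ y.2, ?_, ?_⟩
  · rw [hermitian_self, norm_smul, norm_inv, norm_norm, inv_mul_cancel₀ hy1]
    simp
  · intro i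
    have h : hermitian (w i) (y : FVec F n) = 0 := congrFun (LinearMap.mem_ker.mp hy) i
    unfold hermitian at h ⊢
    rw [WithLp.ofLp_smul, dotProduct_smul, h, smul_zero]

lemma exists_orthonormal_extension {k : ℕ} (E : Submodule Fᵐᵒᵖ (FVec F n))
    (w : Fin k → FVec F n) (hw : ∀ i j, hermitian (w i) (w j) = if i = j then 1 else 0)
    {l : ℕ} (hkl : k ≤ l) (hl : l ≤ Module.finrank Fᵐᵒᵖ E) :
    ∃ v : Fin l → FVec F n, (∀ i j, hermitian (v i) (v j) = if i = j then 1 else 0) ∧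
      (∀ i, v (Fin.castLE hkl i) = w i) ∧ ∀ i : Fin l, k ≤ i → v i ∈ E := by
  induction l, hkl using Nat.le_induction with
  | base => exact ⟨w, hw, fun _ => rfl, fun i hi => absurd i.2 (not_lt.mpr hi)⟩
  | succ l hkl ih =>
    obtain ⟨v, hv, hvw, hvE⟩ := ih (Nat.le_of_succ_le hl)
    obtain ⟨x, hxE, hxx, hvx⟩ := exists_unit_orthogonal E hl v
    refine ⟨Fin.snoc (α := fun _ => FVec F n) v x, fun i j => ?_, fun i => ?_, fun i => ?_⟩
    · induction i using Fin.lastCases with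
      | last =>
        induction j using Fin.lastCases with
        | last => simpa using hxx
        | cast j =>
          rw [Fin.snoc_last, Fin.snoc_castSucc, ← star_hermitian, hvx, star_zero,
            if_neg (Fin.castSucc_ne_last j).symm]
      | cast i =>
        induction j using Fin.lastCases with
        | last =>
          rw [Fin.snoc_last, Fin.snoc_castSucc, hvx, if_neg (Fin.castSucc_ne_last i)]
        | cast j => simp [hv]
    · rw [← hvw i]
      exact Fin.snoc_castSucc (α := fun _ => FVec F n) x v (Fin.castLE hkl i)
    · induction i using Fin.lastCases with
      | last => simpa using fun _ => hxE
      | cast i => simpa using hvE i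

/-- The unitary group acts transitively on the Grassmannian. -/
lemma exists_rotate_base_eq (h : m ≤ n) (E : Gr F n m) :
    ∃ u : UnitaryGp F n, Gr.rotate u (Gr.base F h) = E := by
  have := finite_op_FVec F n
  -- An orthonormal frame of `E`, extended to one of `F^n`: its vectors are the columns of the
  -- required unitary matrix.
  obtain ⟨w, hw, -, hwE⟩ := exists_orthonormal_extension E.1 (Fin.elim0 : Fin 0 → FVec F n)
    (fun i => i.elim0) (Nat.zero_le m) E.2.ge
  obtain ⟨v, hv, hvw, -⟩ := exists_orthonormal_extension (⊤ : Submodule Fᵐᵒᵖ (FVec F n)) w hw h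
    (by rw [finrank_top, finrank_op_FVec])
  let A : Matrix (Fin n) (Fin n) F := Matrix.of fun i j => v j i
  have hA : star A * A = 1 := by
    ext i j
    rw [Matrix.one_apply, ← hv i j]
    rfl
  let u : UnitaryGp F n := ⟨A, hA, mul_eq_one_comm.mp hA⟩
  refine ⟨u, Subtype.ext (Submodule.eq_of_le_of_finrank_eq ?_ ?_)⟩
  · rintro _ ⟨x, hx, rfl⟩
    have hx' : u.equiv x = ∑ j, MulOpposite.op (x j) • v j := by
      ext i
      change ∑ j, v j i * x j = _
      simp
    change u.equiv x ∈ E.1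
    rw [hx']
    refine Submodule.sum_mem _ fun j _ => ?_
    by_cases hj : (j : ℕ) < m
    · refine Submodule.smul_mem _ _ ?_
      have : v j = w ⟨j, hj⟩ := hvw ⟨j, hj⟩
      rw [this]
      exact hwE _ (Nat.zero_le _)
    · rw [hx j (not_lt.mp hj)]
      simp
  · rw [(Gr.rotate u (Gr.base F h)).2, E.2]

variable (F n m) in
/-- The matrix of the inclusion of `F^m` into `F^n` as the subspace of the first coordinates. -/
def coordIncl : Matrix (Fin n) (Fin m) F := Matrix.of fun i j => if (i : ℕ) = j then 1 else 0

lemma conjTranspose_coordIncl_mul (h : m ≤ n) :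
    (coordIncl F n m).conjTranspose * coordIncl F n m = 1 := by
  ext i j
  rw [Matrix.mul_apply, Finset.sum_eq_single (Fin.castLE h i)]
  · simp [coordIncl, Matrix.one_apply, Fin.ext_iff]
  · intro k _ hk
    have : (k : ℕ) ≠ i := fun h' => hk (Fin.ext h')
    simp [coordIncl, this]
  · simp

lemma coordIncl_mul_submatrix (h : m ≤ n) (Y : Matrix (Fin n) (Fin m) F)
    (hY : ∀ i : Fin n, m ≤ i → ∀ j, Y i j = 0) :
    coordIncl F n m * Y.submatrix (Fin.castLE h) id = Y := by
  ext i j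
  rw [Matrix.mul_apply]
  by_cases hi : (i : ℕ) < m
  · rw [Finset.sum_eq_single ⟨i, hi⟩]
    · simp [coordIncl]
    · intro k _ hk
      have : (i : ℕ) ≠ k := fun h' => hk (Fin.ext h'.symm)
      simp [coordIncl, this]
    · simp
  · rw [hY i (not_lt.mp hi)]
    refine Finset.sum_eq_zero fun k _ => ?_
    have : (i : ℕ) ≠ k := fun h' => hi (h' ▸ k.2)
    simp [coordIncl, this]

instance : (unitaryHaar F n).IsHaarMeasure :=
  inferInstanceAs (Measure.haarMeasure _).IsHaarMeasure

/-- Compact groups are unimodular: a right translate is again a Haar probability measure, and such a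
measure is unique. -/
instance : (unitaryHaar F n).IsMulRightInvariant := by
  refine ⟨fun g => ?_⟩
  have : (Measure.map (· * g) (unitaryHaar F n)).IsHaarMeasure :=
    Measure.isHaarMeasure_map_mul_right _ g
  have : IsProbabilityMeasure (Measure.map (· * g) (unitaryHaar F n)) :=
    Measure.isProbabilityMeasure_map (continuous_mul_const g).measurable.aemeasurable
  exact Measure.isHaarMeasure_eq_of_isProbabilityMeasure _ _

section

variable [IsScalarTower ℝ F F] [StarModule ℝ F]

lemma jac_coordIncl (h : m ≤ n) : jac (coordIncl F n m) = 1 := by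
  rw [← sq_eq_sq₀ (jac_nonneg _) zero_le_one, jac_sq, conjTranspose_coordIncl_mul h, realAct_one,
    LinearMap.det_id, one_pow]

/-- A matrix of full rank `m` is the product of an isometry and an invertible matrix. -/
lemma exists_eq_unitary_mul (h : m ≤ n) {X : Matrix (Fin n) (Fin m) F} (hX : jac X ≠ 0) :
    ∃ (v : UnitaryGp F n) (B : Matrix (Fin m) (Fin m) F), jac B ≠ 0 ∧
      X = v.toMatrix * coordIncl F n m * B := by
  have hinj := jac_ne_zero_iff.mp hX
  let f : FVec F m →ₗ[Fᵐᵒᵖ] FVec F n :=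
    { toFun := fun x => WithLp.toLp 2 (X.mulVec x.ofLp)
      map_add' := fun x y => by simp [Matrix.mulVec_add]
      map_smul' := fun a x => by simp [Matrix.mulVec_smul] }
  have hf : Function.Injective f := hinj
  obtain ⟨v, hv⟩ := exists_rotate_base_eq h
    (⟨LinearMap.range f, by rw [LinearMap.finrank_range_of_inj hf, finrank_op_FVec]⟩ : Gr F n m)
  have hv' : Submodule.map (v.equiv : FVec F n →ₗ[Fᵐᵒᵖ] FVec F n) (Gr.coordSubspace F n m)
      = LinearMap.range f := congrArg Subtype.val hv
  have hs : v.toMatrix.conjTranspose * v.toMatrix = 1 := v.star_mul_self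
  have hs' : v.toMatrix * v.toMatrix.conjTranspose = 1 := v.mul_star_self
  -- `v` carries the base subspace onto the range of `X`, so `v*X` has its columns in the base
  -- subspace; its top `m × m` block is the factor `B`.
  have hY : ∀ i : Fin n, m ≤ i → ∀ j, (v.toMatrix.conjTranspose * X) i j = 0 := by
    intro i hi j
    obtain ⟨x, hx, hxj⟩ : f (WithLp.toLp 2 (Pi.single j 1)) ∈ Submodule.map
        (v.equiv : FVec F n →ₗ[Fᵐᵒᵖ] FVec F n) (Gr.coordSubspace F n m) := by
      rw [hv']
      exact LinearMap.mem_range_self _ _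
    have hxj' : realAct X (WithLp.toLp 2 (Pi.single j 1)) = realAct v.toMatrix x := hxj.symm
    rw [← realAct_single (v.toMatrix.conjTranspose * X), realAct_mul, LinearMap.comp_apply,
        hxj', ← LinearMap.comp_apply,
      ← realAct_mul, hs, realAct_one]
    exact hx i hi
  have hfac : X = v.toMatrix * coordIncl F n m
      * (v.toMatrix.conjTranspose * X).submatrix (Fin.castLE h) id := by
    rw [Matrix.mul_assoc, coordIncl_mul_submatrix h _ hY, ← Matrix.mul_assoc, hs',
      Matrix.one_mul]
  refine ⟨v, _, fun h0 => hX ?_, hfac⟩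
  rw [hfac, jac_mul, h0, mul_zero]

end

end Transitivity

/-! ### Integrating densities over the Grassmannian by means of Lebesgue measure on matrices. -/

section GrassmannIntegral

variable {F : Type} [NormedDivisionRing F] [StarRing F] [InnerProductSpace ℝ F]
  [FiniteDimensional ℝ F] [SMulCommClass ℝ F F] [CStarRing F] [StarMulSelf F]
  [IsScalarTower ℝ F F] [StarModule ℝ F]

variable {n m : ℕ}

/-- The Borel σ-algebra on matrices. -/
@[reducible] def matrixMeasurableSpace : MeasurableSpace (Matrix (Fin n) (Fin m) F) := borel _

attribute [local instance] matrixMeasurableSpace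

lemma matrixBorelSpace : BorelSpace (Matrix (Fin n) (Fin m) F) := ⟨rfl⟩

attribute [local instance] matrixBorelSpace

instance : SecondCountableTopology (Matrix (Fin n) (Fin m) F) := by
  have : ProperSpace F := FiniteDimensional.proper_real F
  exact inferInstanceAs (SecondCountableTopology (Fin n → Fin m → F))

instance : LocallyCompactSpace (Matrix (Fin n) (Fin m) F) := by
  have : ProperSpace F := FiniteDimensional.proper_real F
  exact inferInstanceAs (LocallyCompactSpace (Fin n → Fin m → F))

instance : SecondCountableTopology (UnitaryGp F n) :=
  (Topology.IsInducing.subtypeVal :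
    Topology.IsInducing (UnitaryGp.toMatrix : UnitaryGp F n → _)).secondCountableTopology

lemma UnitaryGp.conjTranspose_mul_self (u : UnitaryGp F n) :
    u.toMatrix.conjTranspose * u.toMatrix = 1 := u.star_mul_self

lemma UnitaryGp.jac_toMatrix (u : UnitaryGp F n) : jac u.toMatrix = 1 := by
  rw [← Matrix.mul_one u.toMatrix, jac_isometry_mul u.conjTranspose_mul_self, jac_one]

/-! ### Change of variables -/

/-- `jac` with values in `ℝ≥0∞`. -/
def ejac (X : Matrix (Fin n) (Fin m) F) : ℝ≥0∞ := ENNReal.ofReal (jac X)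

lemma ejac_ne_top (X : Matrix (Fin n) (Fin m) F) : ejac X ≠ ∞ := ENNReal.ofReal_ne_top

lemma ejac_ne_zero {X : Matrix (Fin n) (Fin m) F} (hX : jac X ≠ 0) : ejac X ≠ 0 := by
  simpa [ejac] using lt_of_le_of_ne (jac_nonneg X) hX.symm

lemma ejac_mul (X : Matrix (Fin n) (Fin m) F) (A : Matrix (Fin m) (Fin m) F) :
    ejac (X * A) = ejac X * ejac A := by
  rw [ejac, jac_mul, ENNReal.ofReal_mul (jac_nonneg _)]
  rfl

lemma ejac_pow_ne_top (X : Matrix (Fin n) (Fin m) F) (k : ℕ) : ejac X ^ k ≠ ∞ :=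
  ENNReal.pow_ne_top (ejac_ne_top X)

lemma ejac_pow_ne_zero {X : Matrix (Fin n) (Fin m) F} (hX : jac X ≠ 0) (k : ℕ) :
    ejac X ^ k ≠ 0 := pow_ne_zero k (ejac_ne_zero hX)

lemma measurable_ejac : Measurable (ejac : Matrix (Fin n) (Fin m) F → ℝ≥0∞) :=
  (ENNReal.continuous_ofReal.comp continuous_jac).measurable

lemma isOpen_jac_ne_zero : IsOpen {X : Matrix (Fin n) (Fin m) F | jac X ≠ 0} :=
  isOpen_ne.preimage continuous_jac

variable (μ : Measure (Matrix (Fin n) (Fin m) F)) [hμ : μ.IsAddHaarMeasure]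

lemma lintegral_comp_linear {V : Type*} [NormedAddCommGroup V] [NormedSpace ℝ V]
    [MeasurableSpace V] [BorelSpace V] [FiniteDimensional ℝ V] (ν : Measure V)
    [ν.IsAddHaarMeasure] {T : V →ₗ[ℝ] V} (hT : LinearMap.det T ≠ 0) {f : V → ℝ≥0∞}
    (hf : Measurable f) :
    ∫⁻ x, f (T x) ∂ν = (ENNReal.ofReal |LinearMap.det T|)⁻¹ * ∫⁻ x, f x ∂ν := by
  rw [← lintegral_map hf T.continuous_of_finiteDimensional.measurable,
    Measure.map_linearMap_addHaar_eq_smul_addHaar ν hT, lintegral_smul_measure, abs_inv,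
    ENNReal.ofReal_inv_of_pos (abs_pos.mpr hT), smul_eq_mul]

lemma lintegral_comp_linear_matrix {T : Matrix (Fin n) (Fin m) F →ₗ[ℝ] Matrix (Fin n) (Fin m) F}
    (hT : LinearMap.det T ≠ 0) {f : Matrix (Fin n) (Fin m) F → ℝ≥0∞} (hf : Measurable f) :
    ∫⁻ X, f (T X) ∂μ = (ENNReal.ofReal |LinearMap.det T|)⁻¹ * ∫⁻ X, f X ∂μ := by
  exact @lintegral_comp_linear (Matrix (Fin n) (Fin m) F) Matrix.normedAddCommGroup
    Matrix.normedSpace _ ⟨rfl⟩ _ μ hμ T hT f hf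

lemma measurable_matrix_mul_left {l : ℕ} (A : Matrix (Fin l) (Fin n) F) :
    Measurable fun X : Matrix (Fin n) (Fin m) F => A * X :=
  (continuous_const.matrix_mul continuous_id).measurable

lemma measurable_matrix_mul_right {l : ℕ} (A : Matrix (Fin m) (Fin l) F) :
    Measurable fun X : Matrix (Fin n) (Fin m) F => X * A :=
  (continuous_id.matrix_mul continuous_const).measurable

lemma lintegral_mul_left {A : Matrix (Fin n) (Fin n) F} (hA : jac A ≠ 0)
    {f : Matrix (Fin n) (Fin m) F → ℝ≥0∞} (hf : Measurable f) :
    ∫⁻ X, f (A * X) ∂μ = (ejac A ^ m)⁻¹ * ∫⁻ X, f X ∂μ := by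
  have hT : LinearMap.det (mulLeftLin m A) ≠ 0 := by
    rw [← abs_ne_zero, abs_det_mulLeftLin]
    exact pow_ne_zero _ hA
  rw [ejac, ← ENNReal.ofReal_pow (jac_nonneg A), ← abs_det_mulLeftLin]
  exact lintegral_comp_linear_matrix μ hT hf

lemma lintegral_mul_right {A : Matrix (Fin m) (Fin m) F} (hA : jac A ≠ 0)
    {f : Matrix (Fin n) (Fin m) F → ℝ≥0∞} (hf : Measurable f) :
    ∫⁻ X, f (X * A) ∂μ = (ejac A ^ n)⁻¹ * ∫⁻ X, f X ∂μ := by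
  have hT : LinearMap.det (mulRightLin n A) ≠ 0 := by
    rw [← abs_ne_zero, abs_det_mulRightLin]
    exact pow_ne_zero _ hA
  rw [ejac, ← ENNReal.ofReal_pow (jac_nonneg A), ← abs_det_mulRightLin]
  exact lintegral_comp_linear_matrix μ hT hf

/-! ### Inversion of square matrices -/

lemma continuousOn_ringInverse {R : Type*} [NormedRing R] [CompleteSpace R] {s : Set R}
    (hs : ∀ x ∈ s, IsUnit x) : ContinuousOn Ring.inverse s := by
  intro x hx
  obtain ⟨a, rfl⟩ := hs x hx
  exact (NormedRing.inverse_continuousAt a).continuousWithinAt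

/-- Inversion is continuous on the open set of invertible matrices and is `0` elsewhere. -/
lemma measurable_ringInverse :
    Measurable (Ring.inverse : Matrix (Fin m) (Fin m) F → Matrix (Fin m) (Fin m) F) := by
  have hcont : ContinuousOn (Ring.inverse : Matrix (Fin m) (Fin m) F → Matrix (Fin m) (Fin m) F)
      {A | jac A ≠ 0} := by
    have : CompleteSpace F := FiniteDimensional.complete ℝ F
    have hcomplete : CompleteSpace (Fin m → Fin m → F) := inferInstance
    let R : NormedRing (Matrix (Fin m) (Fin m) F) := Matrix.linftyOpNormedRing
    exact @continuousOn_ringInverse (Matrix (Fin m) (Fin m) F) R hcomplete _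
      fun A hA => jac_ne_zero_iff_isUnit.mp hA
  have h := hcont.measurable_piecewise (continuousOn_const (c := 0))
    isOpen_jac_ne_zero.measurableSet
  convert h using 1
  ext1 A
  by_cases hA : jac A ≠ 0
  · rw [Set.piecewise_eq_of_mem _ _ _ hA]
  · rw [Set.piecewise_eq_of_notMem _ _ _ hA, Ring.inverse_non_unit]
    rwa [← jac_ne_zero_iff_isUnit]

/-- The density of a Haar measure of `GL(m, F)` with respect to the Lebesgue measure. -/
def haarDensity (A : Matrix (Fin m) (Fin m) F) : ℝ≥0∞ :=
  {A : Matrix (Fin m) (Fin m) F | jac A ≠ 0}.indicator (fun A => (ejac A ^ m)⁻¹) A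

lemma measurable_haarDensity : Measurable (haarDensity : Matrix (Fin m) (Fin m) F → ℝ≥0∞) :=
  ((measurable_ejac.pow_const m).inv).indicator isOpen_jac_ne_zero.measurableSet

lemma haarDensity_of_eq_zero {A : Matrix (Fin m) (Fin m) F} (hA : jac A = 0) :
    haarDensity A = 0 := Set.indicator_of_notMem (by simpa using hA) _

/-- With `haarDensity_mul'` this expresses unimodularity of `GL(m, F)`: left and right
multiplication both scale Lebesgue measure by the `m`-th power of `jac`, so the same density
compensates both. -/
lemma haarDensity_mul (A B : Matrix (Fin m) (Fin m) F) (hB : jac B ≠ 0) :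
    haarDensity (A * B) = haarDensity A * (ejac B ^ m)⁻¹ := by
  by_cases hA : jac A = 0
  · rw [haarDensity_of_eq_zero hA, haarDensity_of_eq_zero (by rw [jac_mul, hA, zero_mul]), zero_mul]
  · have hAB : jac (A * B) ≠ 0 := by
      rw [jac_mul]
      exact mul_ne_zero hA hB
    rw [haarDensity, haarDensity, Set.indicator_of_mem (show A ∈ {A | jac A ≠ 0} from hA),
        Set.indicator_of_mem (show A * B ∈ {A | jac A ≠ 0} from hAB), ejac_mul,
      mul_pow, ENNReal.mul_inv (Or.inr (ejac_pow_ne_top _ _)) (Or.inl (ejac_pow_ne_top _ _))]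

lemma haarDensity_mul' (A B : Matrix (Fin m) (Fin m) F) (hA : jac A ≠ 0) :
    haarDensity (A * B) = (ejac A ^ m)⁻¹ * haarDensity B := by
  by_cases hB : jac B = 0
  · rw [haarDensity_of_eq_zero hB, haarDensity_of_eq_zero (by rw [jac_mul, hB, mul_zero]), mul_zero]
  · rw [haarDensity_mul A B hB, haarDensity, haarDensity,
      Set.indicator_of_mem (show A ∈ {A | jac A ≠ 0} from hA),
      Set.indicator_of_mem (show B ∈ {A | jac A ≠ 0} from hB)]

/-! ### Homogeneous functions and the exchange formula -/

/-- A function on full-rank matrices which is homogeneous of degree `-n` under `GL(m, F)`, hence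
corresponds to a density on the Grassmannian. -/
structure IsDensity (h : Matrix (Fin n) (Fin m) F → ℝ≥0∞) : Prop where
  measurable : Measurable h
  mul_right : ∀ (X : Matrix (Fin n) (Fin m) F) (A : Matrix (Fin m) (Fin m) F),
      jac X ≠ 0 → jac A ≠ 0 → h (X * A) = (ejac A ^ n)⁻¹ * h X

lemma IsDensity.comp_mul_left {h : Matrix (Fin n) (Fin m) F → ℝ≥0∞} (hh : IsDensity h)
    {g : Matrix (Fin n) (Fin n) F} (hg : jac g ≠ 0) : IsDensity fun X :
        Matrix (Fin n) (Fin m) F => h (g * X) where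
  measurable := hh.measurable.comp (measurable_matrix_mul_left _)
  mul_right X A hX hA := by
    rw [← Matrix.mul_assoc]
    exact hh.mul_right _ _ ((jac_mul_left_ne_zero hg).mpr hX) hA

lemma isDensity_ejac : IsDensity fun X : Matrix (Fin n) (Fin m) F => (ejac X ^ n)⁻¹ where
  measurable := (measurable_ejac.pow_const n).inv
  mul_right X A _ _ := by
    rw [ejac_mul, mul_pow, ENNReal.mul_inv (Or.inr (ejac_pow_ne_top _ _))
      (Or.inl (ejac_pow_ne_top _ _)), mul_comm]

variable (κ : Measure (Matrix (Fin m) (Fin m) F)) [κ.IsAddHaarMeasure]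

/-- Tonelli, then the substitution `Y = XA` for each fixed `A`. The measure `h dμ` is invariant
under it, because the degree `-n` of `h` cancels the Jacobian of right multiplication. -/
lemma lintegral_exchange {h w₁ w₂ : Matrix (Fin n) (Fin m) F → ℝ≥0∞} (hh : IsDensity h)
    (hw₁ : Measurable w₁) (hw₂ : Measurable w₂) (hw₂' : ∀ X, jac X = 0 → w₂ X = 0) :
    ∫⁻ X : Matrix (Fin n) (Fin m) F, h X * w₁ X * ∫⁻ A : Matrix (Fin m) (Fin m) F,
        w₂ (X * A) * haarDensity A ∂κ ∂μ
      = ∫⁻ X : Matrix (Fin n) (Fin m) F, h X * w₂ X * ∫⁻ A : Matrix (Fin m) (Fin m) F,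
          w₁ (X * Ring.inverse A) * haarDensity A ∂κ ∂μ := by
  have hm : Measurable fun p : Matrix (Fin n) (Fin m) F × Matrix (Fin m) (Fin m) F => p.1 * p.2 :=
    (continuous_fst.matrix_mul continuous_snd).measurable
  have hm' : Measurable fun p : Matrix (Fin n) (Fin m) F × Matrix (Fin m) (Fin m) F =>
      p.1 * Ring.inverse p.2 :=
    hm.comp (measurable_fst.prodMk (measurable_ringInverse.comp measurable_snd))
  have h₁ : Measurable fun p : Matrix (Fin n) (Fin m) F × Matrix (Fin m) (Fin m) F =>
      w₂ (p.1 * p.2) * haarDensity p.2 :=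
    (hw₂.comp hm).mul (measurable_haarDensity.comp measurable_snd)
  have h₂ : Measurable fun p : Matrix (Fin n) (Fin m) F × Matrix (Fin m) (Fin m) F =>
      w₁ (p.1 * Ring.inverse p.2) * haarDensity p.2 :=
    (hw₁.comp hm').mul (measurable_haarDensity.comp measurable_snd)
  have e₁ : ∀ X, h X * w₁ X * ∫⁻ A : Matrix (Fin m) (Fin m) F, w₂ (X * A) * haarDensity A ∂κ
      = ∫⁻ A : Matrix (Fin m) (Fin m) F, h X * w₁ X * (w₂ (X * A) * haarDensity A) ∂κ := fun X =>
    (lintegral_const_mul _ (h₁.comp measurable_prodMk_left)).symm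
  have e₂ : ∀ X, h X * w₂ X * ∫⁻ A : Matrix (Fin m) (Fin m) F,
      w₁ (X * Ring.inverse A) * haarDensity A ∂κ
      = ∫⁻ A : Matrix (Fin m) (Fin m) F, h X * w₂ X * (w₁
          (X * Ring.inverse A) * haarDensity A) ∂κ := fun X =>
    (lintegral_const_mul _ (h₂.comp measurable_prodMk_left)).symm
  simp_rw [e₁, e₂]
  rw [lintegral_lintegral_swap (f := fun (X : Matrix (Fin n) (Fin m) F) (A :
      Matrix (Fin m) (Fin m) F) => h X * w₁ X * (w₂ (X * A) * haarDensity A))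
      (((hh.measurable.mul hw₁).comp measurable_fst).mul h₁).aemeasurable,
    lintegral_lintegral_swap
      (f := fun (X : Matrix (Fin n) (Fin m) F) (A : Matrix (Fin m) (Fin m) F) =>
          h X * w₂ X * (w₁ (X * Ring.inverse A) * haarDensity A))
      (((hh.measurable.mul hw₂).comp measurable_fst).mul h₂).aemeasurable]
  refine lintegral_congr fun A => ?_
  -- The density vanishes on singular `A`, where `Ring.inverse` has only its default value.
  by_cases hA : jac A = 0
  · simp [haarDensity_of_eq_zero hA]
  obtain ⟨a, rfl⟩ := jac_ne_zero_iff_isUnit.mp hA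
  rw [Ring.inverse_unit]
  set B : Matrix (Fin m) (Fin m) F := ↑a⁻¹
  have hAB : (a : Matrix (Fin m) (Fin m) F) * B = 1 := a.mul_inv
  have hBA : B * (a : Matrix (Fin m) (Fin m) F) = 1 := a.inv_mul
  have hB : jac B ≠ 0 := jac_ne_zero_of_mul_eq_one hBA
  have hmB : Measurable fun X : Matrix (Fin n) (Fin m) F => X * B :=
    (measurable_matrix_mul_right _)
  set r := haarDensity (a : Matrix (Fin m) (Fin m) F)
  let Φ : Matrix (Fin n) (Fin m) F → ℝ≥0∞ := fun Y => h (Y * B) * w₁ (Y * B) * (w₂ Y * r)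
  have hΦ : Measurable Φ :=
    ((hh.measurable.comp hmB).mul (hw₁.comp hmB)).mul (hw₂.mul_const r)
  have hΦ' : ∀ X : Matrix (Fin n) (Fin m) F, h X * w₁ X * (w₂ (X * (a :
      Matrix (Fin m) (Fin m) F)) * r)
      = Φ (X * (a : Matrix (Fin m) (Fin m) F)) := by
    intro X
    simp only [Φ, Matrix.mul_assoc, hAB, Matrix.mul_one]
  simp_rw [hΦ']
  rw [lintegral_mul_right μ hA hΦ, ← lintegral_const_mul _ hΦ]
  refine lintegral_congr fun Y => ?_
  -- Homogeneity of `h` is available only at full rank; elsewhere `w₂` is zero.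
  by_cases hY : jac Y = 0
  · simp [Φ, hw₂' Y hY]
  simp only [Φ]
  rw [hh.mul_right Y B hY hB]
  have hc : (ejac (a : Matrix (Fin m) (Fin m) F) ^ n)⁻¹ * (ejac B ^ n)⁻¹ = 1 := by
    rw [← ENNReal.mul_inv (Or.inr (ejac_pow_ne_top _ _)) (Or.inl (ejac_pow_ne_top _ _)),
      ← mul_pow, ← ejac_mul, hAB, ejac, jac_one]
    simp
  calc _ = (ejac (a : Matrix (Fin m) (Fin m) F) ^ n)⁻¹ * (ejac B ^ n)⁻¹
        * (h Y * w₂ Y * (w₁ (Y * B) * r)) := by ring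
    _ = _ := by rw [hc, one_mul]

/-! ### The reference weight -/

/-- The euclidean norm of a column. -/
def colNorm (X : Matrix (Fin n) (Fin m) F) (j : Fin m) : ℝ :=
  ‖realAct X (WithLp.toLp 2 (Pi.single j 1))‖

lemma continuous_colNorm (j : Fin m) :
    Continuous fun X : Matrix (Fin n) (Fin m) F => colNorm X j :=
  continuous_norm.comp (continuous_realAct_prod.comp (continuous_id.prodMk continuous_const))

lemma colNorm_isometry_mul {l : ℕ} {Y : Matrix (Fin l) (Fin n) F} (hY : Y.conjTranspose * Y = 1)
    (X : Matrix (Fin n) (Fin m) F) (j : Fin m) : colNorm (Y * X) j = colNorm X j := by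
  rw [colNorm, realAct_mul, LinearMap.comp_apply, norm_realAct_of_isometry hY]
  rfl

variable (F n m) in
/-- The matrices of full rank whose columns have norm at most `1`. -/
def fullRankBall : Set (Matrix (Fin n) (Fin m) F) := {X | (∀ j, colNorm X j ≤ 1) ∧ jac X ≠ 0}

variable (F n m) in
lemma isClosed_colNorm_le_one :
    IsClosed {X : Matrix (Fin n) (Fin m) F | ∀ j, colNorm X j ≤ 1} := by
  have h : {X : Matrix (Fin n) (Fin m) F | ∀ j, colNorm X j ≤ 1}
      = ⋂ j, {X : Matrix (Fin n) (Fin m) F | colNorm X j ≤ 1} := by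
    ext X
    simp
  rw [h]
  exact isClosed_iInter fun j => isClosed_le (continuous_colNorm j) continuous_const

variable (F n m) in
lemma measurableSet_fullRankBall : MeasurableSet (fullRankBall F n m) :=
  (isClosed_colNorm_le_one F n m).measurableSet.inter isOpen_jac_ne_zero.measurableSet

variable (F n m) in
lemma isCompact_colNorm_le_one :
    IsCompact {X : Matrix (Fin n) (Fin m) F | ∀ j, colNorm X j ≤ 1} := by
  have : ProperSpace F := FiniteDimensional.proper_real F
  have hb : IsCompact {X : Matrix (Fin n) (Fin m) F | ∀ i ∈ Set.univ, ∀ j ∈ Set.univ,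
      X i j ∈ Metric.closedBall (0 : F) 1} :=
    isCompact_univ_pi fun _ => isCompact_univ_pi fun _ => isCompact_closedBall _ _
  refine hb.of_isClosed_subset (isClosed_colNorm_le_one F n m) fun X hX i _ j _ => ?_
  rw [mem_closedBall_zero_iff, ← realAct_single X]
  exact (PiLp.norm_apply_le _ i).trans (hX j)

lemma measure_fullRankBall_ne_top : μ (fullRankBall F n m) ≠ ∞ :=
  ((measure_mono fun _ (hX : _ ∈ fullRankBall F n m) =>
      hX.1).trans_lt (isCompact_colNorm_le_one F n m).measure_lt_top).ne

lemma measure_fullRankBall_ne_zero (hmn : m ≤ n) : μ (fullRankBall F n m) ≠ 0 := by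
  have hopen : IsOpen {X : Matrix (Fin n) (Fin m) F | (∀ j, colNorm X j < 1) ∧ jac X ≠ 0} := by
    have h : {X : Matrix (Fin n) (Fin m) F | ∀ j, colNorm X j < 1}
        = ⋂ j, {X : Matrix (Fin n) (Fin m) F | colNorm X j < 1} := by
      ext X
      simp
    have h' : IsOpen {X : Matrix (Fin n) (Fin m) F | ∀ j, colNorm X j < 1} := by
      rw [h]
      exact isOpen_iInter_of_finite fun j => isOpen_lt (continuous_colNorm j) continuous_const
    exact h'.inter isOpen_jac_ne_zero
  have hne : {X : Matrix (Fin n) (Fin m) F | (∀ j, colNorm X j < 1) ∧ jac X ≠ 0}.Nonempty := by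
    have hsmul : ∀ x, realAct ((1 / 2 : ℝ) • coordIncl F n m) x
        = (1 / 2 : ℝ) • realAct (coordIncl F n m) x := fun x =>
      congrArg (fun T => T x) (map_smul (realActCLM F n m) (1 / 2 : ℝ) (coordIncl F n m))
    -- Halving an isometry gives columns of norm `1/2`, strictly inside the bound.
    refine ⟨(1 / 2 : ℝ) • coordIncl F n m, fun j => ?_, ?_⟩
    · rw [colNorm, hsmul, norm_smul, norm_realAct_of_isometry (conjTranspose_coordIncl_mul hmn)]
      simp
      norm_num
    · rw [jac_ne_zero_iff]
      have hinj : Function.Injective (realAct (coordIncl F n m)) := by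
        rw [← jac_ne_zero_iff, jac_coordIncl hmn]
        exact one_ne_zero
      intro x y hxy
      rw [hsmul, hsmul] at hxy
      exact hinj (smul_right_injective _ (by norm_num : (1 / 2 : ℝ) ≠ 0) hxy)
  have hsub : {X : Matrix (Fin n) (Fin m) F | (∀ j, colNorm X j < 1) ∧ jac X ≠ 0}
      ⊆ fullRankBall F n m := fun _ hX => ⟨fun j => (hX.1 j).le, hX.2⟩
  exact ((hopen.measure_pos μ hne).trans_le (measure_mono hsub)).ne'

/-- A bounded weight on the matrices of full rank which is invariant under the unitary group. -/
def ballWeight (X : Matrix (Fin n) (Fin m) F) : ℝ≥0∞ :=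
  (fullRankBall F n m).indicator (fun X => ejac X ^ n) X

lemma measurable_ballWeight : Measurable (ballWeight : Matrix (Fin n) (Fin m) F → ℝ≥0∞) :=
  (measurable_ejac.pow_const n).indicator (measurableSet_fullRankBall F n m)

lemma ballWeight_of_jac_eq_zero {X : Matrix (Fin n) (Fin m) F} (hX : jac X = 0) :
    ballWeight X = 0 := Set.indicator_of_notMem (fun h => h.2 hX) _

lemma ballWeight_unitary_mul (u : UnitaryGp F n) (X : Matrix (Fin n) (Fin m) F) :
    ballWeight (u.toMatrix * X) = ballWeight X := by
  simp only [ballWeight, fullRankBall, Set.indicator_apply, Set.mem_ofPred_eq, ejac,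
    colNorm_isometry_mul u.conjTranspose_mul_self,
    jac_isometry_mul u.conjTranspose_mul_self]

lemma lintegral_ejac_inv_mul_ballWeight :
    ∫⁻ X : Matrix (Fin n) (Fin m) F, (ejac X ^ n)⁻¹ * ballWeight X ∂μ
      = μ (fullRankBall F n m) := by
  rw [← lintegral_indicator_one (measurableSet_fullRankBall F n m)]
  refine lintegral_congr fun X => ?_
  by_cases hX : X ∈ fullRankBall F n m
  · rw [ballWeight, Set.indicator_of_mem hX, Set.indicator_of_mem hX,
      ENNReal.inv_mul_cancel (ejac_pow_ne_zero hX.2 n) (ejac_pow_ne_top _ _)]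
    rfl
  · rw [ballWeight, Set.indicator_of_notMem hX, Set.indicator_of_notMem hX, mul_zero]

/-- The integral of `ballWeight` over a fibre of the map `X ↦ range X`. -/
def fibreIntegral (n : ℕ) (κ : Measure (Matrix (Fin m) (Fin m) F)) : ℝ≥0∞ :=
  ∫⁻ A : Matrix (Fin m) (Fin m) F, ballWeight (coordIncl F n m * A) * haarDensity A ∂κ

/-- All orbit integrals of the weight agree. Factor `X` as unitary times `coordIncl` times `B`:
unitary invariance removes the first factor, left invariance of the Haar measure of `GL(m, F)`
absorbs `B`. -/
lemma lintegral_ballWeight_mul (hmn : m ≤ n) {X : Matrix (Fin n) (Fin m) F} (hX : jac X ≠ 0) :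
    ∫⁻ A : Matrix (Fin m) (Fin m) F, ballWeight (X * A) * haarDensity A ∂κ = fibreIntegral n κ := by
  obtain ⟨v, B, hB, rfl⟩ := exists_eq_unitary_mul hmn hX
  have hf : Measurable fun A : Matrix (Fin m) (Fin m) F =>
      ballWeight (coordIncl F n m * A) * haarDensity A :=
    (measurable_ballWeight.comp (measurable_matrix_mul_left _)).mul
      measurable_haarDensity
  have h1 := lintegral_mul_left κ hB hf
  have h2 : ∀ A : Matrix (Fin m) (Fin m) F, ballWeight
      (v.toMatrix * coordIncl F n m * B * A) * haarDensity A
      = ejac B ^ m * (ballWeight (coordIncl F n m * (B * A)) * haarDensity (B * A)) := by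
    intro A
    rw [haarDensity_mul' B A hB, Matrix.mul_assoc, Matrix.mul_assoc, ballWeight_unitary_mul,
      mul_left_comm, ← mul_assoc (ejac B ^ m),
      ENNReal.mul_inv_cancel (ejac_pow_ne_zero hB m) (ejac_pow_ne_top _ _), one_mul]
  simp_rw [h2]
  rw [lintegral_const_mul _ (hf.fun_comp (measurable_matrix_mul_left B)), h1,
    ← mul_assoc, ENNReal.mul_inv_cancel (ejac_pow_ne_zero hB m) (ejac_pow_ne_top _ _), one_mul]
  rfl

/-- The same argument with right invariance, since `b A⁻¹ = (A b⁻¹)⁻¹`. -/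
lemma lintegral_ballWeight_mul_inverse (hmn : m ≤ n) {X : Matrix (Fin n) (Fin m) F}
    (hX : jac X ≠ 0) :
    ∫⁻ A : Matrix (Fin m) (Fin m) F, ballWeight (X * Ring.inverse A) * haarDensity A ∂κ
      = ∫⁻ A : Matrix (Fin m) (Fin m) F, ballWeight
          (coordIncl F n m * Ring.inverse A) * haarDensity A ∂κ := by
  obtain ⟨v, B, hB, rfl⟩ := exists_eq_unitary_mul hmn hX
  obtain ⟨b, rfl⟩ := jac_ne_zero_iff_isUnit.mp hB
  set C : Matrix (Fin m) (Fin m) F := ↑b⁻¹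
  have hC : jac C ≠ 0 := jac_ne_zero_iff_isUnit.mpr (b⁻¹).isUnit
  have hf : Measurable fun A : Matrix (Fin m) (Fin m) F =>
      ballWeight (coordIncl F n m * Ring.inverse A) * haarDensity A :=
    (measurable_ballWeight.comp ((measurable_matrix_mul_left _).comp
      measurable_ringInverse)).mul measurable_haarDensity
  have h1 := lintegral_mul_right κ hC hf
  have h2 : ∀ A : Matrix (Fin m) (Fin m) F, ballWeight (v.toMatrix * coordIncl F n m * (b :
      Matrix (Fin m) (Fin m) F)
      * Ring.inverse A) * haarDensity A
      = ejac C ^ m * (ballWeight (coordIncl F n m * Ring.inverse (A * C))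
        * haarDensity (A * C)) := by
    intro A
    by_cases hA : jac A = 0
    · rw [haarDensity_mul A C hC, haarDensity_of_eq_zero hA, zero_mul, mul_zero, mul_zero, mul_zero]
    obtain ⟨a, rfl⟩ := jac_ne_zero_iff_isUnit.mp hA
    have hinv : Ring.inverse ((a : Matrix (Fin m) (Fin m) F) * C)
        = (b : Matrix (Fin m) (Fin m) F) * Ring.inverse (a : Matrix (Fin m) (Fin m) F) := by
      rw [← Units.val_mul, Ring.inverse_unit, Ring.inverse_unit, mul_inv_rev, inv_inv,
        Units.val_mul]
    rw [haarDensity_mul _ C hC, hinv, Matrix.mul_assoc, Matrix.mul_assoc, ballWeight_unitary_mul,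
      mul_comm (ejac C ^ m), mul_assoc, mul_assoc,
      ENNReal.inv_mul_cancel (ejac_pow_ne_zero hC m) (ejac_pow_ne_top _ _), mul_one]
  simp_rw [h2]
  rw [lintegral_const_mul _ (hf.fun_comp (measurable_matrix_mul_right C)), h1,
    ← mul_assoc, ENNReal.mul_inv_cancel (ejac_pow_ne_zero hC m) (ejac_pow_ne_top _ _), one_mul]

/-- The power `n` in the weight outweighs the power `-m` in the Haar density. The exponent `n - m`
is nonnegative, so the integrand is bounded and the orbit integral is finite. -/
lemma ballWeight_coordIncl_mul (hmn : m ≤ n) (A : Matrix (Fin m) (Fin m) F) :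
    ballWeight (coordIncl F n m * A) * haarDensity A
      = (fullRankBall F m m).indicator (fun A => ejac A ^ (n - m)) A := by
  have hmem : coordIncl F n m * A ∈ fullRankBall F n m ↔ A ∈ fullRankBall F m m := by
    simp only [fullRankBall, Set.mem_ofPred_eq,
      colNorm_isometry_mul (conjTranspose_coordIncl_mul hmn),
      jac_isometry_mul (conjTranspose_coordIncl_mul hmn)]
  by_cases hA : A ∈ fullRankBall F m m
  · rw [ballWeight, Set.indicator_of_mem (hmem.mpr hA), haarDensity,
      Set.indicator_of_mem (show A ∈ {A | jac A ≠ 0} from hA.2), Set.indicator_of_mem hA, ejac,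
      jac_isometry_mul (conjTranspose_coordIncl_mul hmn)]
    change ejac A ^ n * _ = _
    nth_rewrite 1 [← Nat.sub_add_cancel hmn]
    rw [pow_add, mul_assoc, ENNReal.mul_inv_cancel (ejac_pow_ne_zero hA.2 m) (ejac_pow_ne_top _ _),
      mul_one]
  · rw [ballWeight, Set.indicator_of_notMem (fun h => hA (hmem.mp h)), Set.indicator_of_notMem hA,
      zero_mul]

lemma fibreIntegral_ne_zero (hmn : m ≤ n) : fibreIntegral n κ ≠ 0 := by
  unfold fibreIntegral
  simp_rw [ballWeight_coordIncl_mul hmn]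
  rw [lintegral_indicator (measurableSet_fullRankBall F m m)]
  intro h0
  rw [lintegral_eq_zero_iff (measurable_ejac.pow_const _), Filter.EventuallyEq,
    ae_restrict_iff' (measurableSet_fullRankBall F m m)] at h0
  refine measure_fullRankBall_ne_zero κ le_rfl (measure_mono_null (fun A hA => ?_) h0)
  intro h
  exact ejac_pow_ne_zero hA.2 _ (h hA)

lemma fibreIntegral_ne_top (hmn : m ≤ n) : fibreIntegral n κ ≠ ∞ := by
  unfold fibreIntegral
  simp_rw [ballWeight_coordIncl_mul hmn]
  obtain ⟨M, hM⟩ := (isCompact_colNorm_le_one F m m).bddAbove_image continuous_jac.continuousOn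
  refine ne_top_of_le_ne_top (b := ENNReal.ofReal M ^ (n - m) * κ (fullRankBall F m m)) ?_ ?_
  · exact ENNReal.mul_ne_top (ENNReal.pow_ne_top ENNReal.ofReal_ne_top)
      (measure_fullRankBall_ne_top κ)
  · rw [← lintegral_indicator_const (measurableSet_fullRankBall F m m)]
    refine lintegral_mono fun A => Set.indicator_le_indicator' fun hA => ?_
    exact pow_le_pow_left' (ENNReal.ofReal_le_ofReal (hM ⟨A, hA.1, rfl⟩)) _

/-! ### Invariance -/

/-- The weights `w` and `w(g ·)` have the same orbit integrals, so exchanging them leaves the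
integral against `h` unchanged. Invertibility of `g` is enough here. -/
lemma lintegral_ballWeight_comp (hmn : m ≤ n) {h : Matrix (Fin n) (Fin m) F → ℝ≥0∞}
    (hh : IsDensity h) {g : Matrix (Fin n) (Fin n) F} (hg : jac g ≠ 0) :
    ∫⁻ X : Matrix (Fin n) (Fin m) F, h X * ballWeight (g * X) ∂μ = ∫⁻ X :
        Matrix (Fin n) (Fin m) F, h X * ballWeight X ∂μ := by
  let κ : Measure (Matrix (Fin m) (Fin m) F) := Measure.addHaar
  set c := fibreIntegral n κ
  set c' := ∫⁻ A : Matrix (Fin m) (Fin m) F, ballWeight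
      (coordIncl F n m * Ring.inverse A) * haarDensity A ∂κ
  have key : ∀ {h : Matrix (Fin n) (Fin m) F → ℝ≥0∞}, IsDensity h →
      ∀ {g : Matrix (Fin n) (Fin n) F}, jac g ≠ 0 →
      (∫⁻ X : Matrix (Fin n) (Fin m) F, h X * ballWeight X ∂μ) * c = (∫⁻ X :
          Matrix (Fin n) (Fin m) F, h X * ballWeight (g * X) ∂μ) * c' := by
    intro h hh g hg
    have hw : Measurable fun X : Matrix (Fin n) (Fin m) F => ballWeight (g * X) :=
      measurable_ballWeight.comp (measurable_matrix_mul_left _)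
    have hw' : ∀ X : Matrix (Fin n) (Fin m) F, jac X = 0 → ballWeight (g * X) = 0 := by
      intro X hX
      refine ballWeight_of_jac_eq_zero (not_not.mp fun h => ?_)
      exact (jac_mul_left_ne_zero hg).mp h hX
    rw [← lintegral_mul_const _ (hh.measurable.fun_mul measurable_ballWeight),
      ← lintegral_mul_const _ (hh.measurable.fun_mul hw)]
    refine Eq.trans (lintegral_congr fun X => ?_) ((lintegral_exchange μ κ hh
      measurable_ballWeight hw hw').trans (lintegral_congr fun X => ?_))
    · by_cases hX : jac X = 0
      · simp [ballWeight_of_jac_eq_zero hX]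
      · simp_rw [← Matrix.mul_assoc]
        rw [lintegral_ballWeight_mul κ hmn ((jac_mul_left_ne_zero hg).mpr hX)]
    · by_cases hX : jac X = 0
      · simp [hw' X hX]
      · rw [lintegral_ballWeight_mul_inverse κ hmn hX]
  -- Rather than invoking invariance of Haar measure under inversion, the two constants are compared
  -- on the model density with `g = 1`, where both integrals are the volume of `fullRankBall`.
  have hcc' : c = c' := by
    have h1 := key isDensity_ejac (g := 1) (by rw [jac_one]; exact one_ne_zero)
    simp only [Matrix.one_mul, lintegral_ejac_inv_mul_ballWeight] at h1
    exact (ENNReal.mul_right_inj (measure_fullRankBall_ne_zero μ hmn)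
      (measure_fullRankBall_ne_top μ)).mp h1
  have h2 := key hh hg
  rw [← hcc'] at h2
  exact ((ENNReal.mul_left_inj (fibreIntegral_ne_zero κ hmn) (fibreIntegral_ne_top κ hmn)).mp
    h2).symm

/-- Both `μ` and the weight are unitarily invariant, so `h(X)` may be averaged over `h(uX)`. By
homogeneity the average is `jac(X)^{-n}` times the unitary integral, and this factor reduces the
weight to the indicator of `fullRankBall`. -/
lemma lintegral_ballWeight_eq (hmn : m ≤ n) {h : Matrix (Fin n) (Fin m) F → ℝ≥0∞}
    (hh : IsDensity h) :
    ∫⁻ X : Matrix (Fin n) (Fin m) F, h X * ballWeight X ∂μ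
      = μ (fullRankBall F n m)
        * ∫⁻ u : UnitaryGp F n, h (u.toMatrix * coordIncl F n m) ∂(unitaryHaar F n) := by
  have hmU : Measurable fun p : UnitaryGp F n × Matrix (Fin n) (Fin m) F =>
      p.1.toMatrix * p.2 :=
    ((UnitaryGp.continuous_toMatrix.comp continuous_fst).matrix_mul continuous_snd).measurable
  have h1 : ∀ u : UnitaryGp F n, ∫⁻ X : Matrix (Fin n) (Fin m) F,
      h (u.toMatrix * X) * ballWeight X ∂μ
      = ∫⁻ X : Matrix (Fin n) (Fin m) F, h X * ballWeight X ∂μ := by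
    intro u
    have hu : jac u.toMatrix ≠ 0 := by
      rw [u.jac_toMatrix]
      exact one_ne_zero
    have := lintegral_mul_left μ hu (hh.measurable.fun_mul measurable_ballWeight)
    simp only [ballWeight_unitary_mul, ejac, u.jac_toMatrix, ENNReal.ofReal_one,
      one_pow, inv_one, one_mul] at this
    exact this
  have h2 : ∫⁻ X : Matrix (Fin n) (Fin m) F, h X * ballWeight X ∂μ
      = ∫⁻ u : UnitaryGp F n, ∫⁻ X : Matrix (Fin n) (Fin m) F,
          h (u.toMatrix * X) * ballWeight X ∂μ ∂(unitaryHaar F n) := by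
    simp_rw [h1]
    rw [lintegral_const, measure_univ, mul_one]
  rw [h2, lintegral_lintegral_swap, ← lintegral_ejac_inv_mul_ballWeight,
    ← lintegral_mul_const _ (isDensity_ejac.measurable.fun_mul measurable_ballWeight)]
  swap
  · exact ((hh.measurable.comp hmU).mul
      (measurable_ballWeight.comp measurable_snd)).aemeasurable
  refine lintegral_congr fun X => ?_
  by_cases hX : jac X = 0
  · simp [ballWeight_of_jac_eq_zero hX]
  have hmX : Measurable fun u : UnitaryGp F n => h (u.toMatrix * X) :=
    hh.measurable.comp (hmU.comp measurable_prodMk_right)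
  rw [lintegral_mul_const _ hmX]
  obtain ⟨v, B, hB, rfl⟩ := exists_eq_unitary_mul hmn hX
  have hcI : jac (coordIncl F n m) ≠ 0 := by
    rw [jac_coordIncl hmn]
    exact one_ne_zero
  have h3 : ∀ u : UnitaryGp F n, h (u.toMatrix * (v.toMatrix * coordIncl F n m * B))
      = (ejac B ^ n)⁻¹ * h ((u * v).toMatrix * coordIncl F n m) := by
    intro u
    rw [← Matrix.mul_assoc, ← Matrix.mul_assoc, ← UnitaryGp.toMatrix_mul]
    refine hh.mul_right _ _ ?_ hB
    rw [jac_isometry_mul (u * v).conjTranspose_mul_self]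
    exact hcI
  have hmI : Measurable fun u : UnitaryGp F n => h (u.toMatrix * coordIncl F n m) :=
    hh.measurable.comp (hmU.comp measurable_prodMk_right)
  simp_rw [h3]
  rw [lintegral_const_mul _ (hmI.fun_comp (measurable_mul_const v)),
    lintegral_mul_right_eq_self (fun u : UnitaryGp F n => h (u.toMatrix * coordIncl F n m)) v]
  have h4 : ejac (v.toMatrix * coordIncl F n m * B) = ejac B := by
    rw [ejac_mul, ejac, jac_isometry_mul v.conjTranspose_mul_self, jac_coordIncl hmn,
      ENNReal.ofReal_one, one_mul]
  rw [h4]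
  ring

/-- The integral of a density over the Grassmannian is invariant under volume preserving linear
maps. -/
theorem lintegral_unitary_comp_mul_left (hmn : m ≤ n) {h : Matrix (Fin n) (Fin m) F → ℝ≥0∞}
    (hh : IsDensity h) {g : Matrix (Fin n) (Fin n) F} (hg : jac g = 1) :
    ∫⁻ u : UnitaryGp F n, h (g * (u.toMatrix * coordIncl F n m)) ∂(unitaryHaar F n)
      = ∫⁻ u : UnitaryGp F n, h (u.toMatrix * coordIncl F n m) ∂(unitaryHaar F n) := by
  have hg0 : jac g ≠ 0 := by
    rw [hg]
    exact one_ne_zero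
  obtain ⟨g', hgg', hg'g⟩ := exists_inverse_of_jac_ne_zero hg0
  let μ : Measure (Matrix (Fin n) (Fin m) F) := Measure.addHaar
  have h1 := lintegral_ballWeight_eq μ hmn (hh.comp_mul_left hg0)
  have h2 := lintegral_ballWeight_eq μ hmn hh
  have hw : Measurable fun X : Matrix (Fin n) (Fin m) F => ballWeight (g' * X) :=
    measurable_ballWeight.comp (measurable_matrix_mul_left _)
  -- The substitution `X ↦ gX` moves `g` from `h` to the weight; its Jacobian is `1` because `jac g
  -- = 1`.
  have h3 := lintegral_mul_left μ hg0 (hh.measurable.fun_mul hw)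
  simp only [← Matrix.mul_assoc, hg'g, Matrix.one_mul, ejac, hg, ENNReal.ofReal_one,
    one_pow, inv_one, one_mul] at h3
  rw [h3, lintegral_ballWeight_comp μ hmn hh (jac_ne_zero_of_mul_eq_one hg'g), h2] at h1
  exact ((ENNReal.mul_right_inj (measure_fullRankBall_ne_zero μ hmn)
    (measure_fullRankBall_ne_top μ)).mp h1).symm

end GrassmannIntegral

/-! ### Determinants of real block maps. -/

section BlockDeterminant

variable {V W : Type*} [AddCommGroup V] [Module ℝ V] [FiniteDimensional ℝ V]
  [AddCommGroup W] [Module ℝ W] [FiniteDimensional ℝ W]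

/-- The map `(x, y) ↦ (x + ρ y, y)`. -/
def shear (ρ : W →ₗ[ℝ] V) : V × W →ₗ[ℝ] V × W :=
  (LinearMap.fst ℝ V W + ρ ∘ₗ LinearMap.snd ℝ V W).prod (LinearMap.snd ℝ V W)

lemma shear_apply (ρ : W →ₗ[ℝ] V) (p : V × W) : shear ρ p = (p.1 + ρ p.2, p.2) := rfl

lemma shear_comp_shear (ρ σ : W →ₗ[ℝ] V) : shear ρ ∘ₗ shear σ = shear (ρ + σ) := by
  ext p <;> simp [shear_apply, add_comm]

/-- Doubling the first coordinate conjugates the shear into its own square. So its determinant `d`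
satisfies `d² = d`, and `d ≠ 0` because the shear is invertible. -/
lemma det_shear (ρ : W →ₗ[ℝ] V) : LinearMap.det (shear ρ) = 1 := by
  let e : (V × W) ≃ₗ[ℝ] V × W :=
    (LinearEquiv.smulOfNeZero ℝ V (2 : ℝ) two_ne_zero).prodCongr (LinearEquiv.refl ℝ W)
  have h1 : (e : _ →ₗ[ℝ] _) ∘ₗ shear ρ ∘ₗ (e.symm : _ →ₗ[ℝ] _) = shear ρ ∘ₗ shear ρ := by
    rw [shear_comp_shear]
    refine LinearMap.ext fun p => ?_
    obtain ⟨q, rfl⟩ := e.surjective p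
    simp only [LinearMap.comp_apply, LinearEquiv.coe_coe, LinearEquiv.symm_apply_apply]
    refine Prod.ext ?_ rfl
    change (2 : ℝ) • (q.1 + ρ q.2) = (2 : ℝ) • q.1 + (ρ q.2 + ρ q.2)
    rw [smul_add, two_smul ℝ (ρ q.2)]
  have h2 := LinearMap.det_conj (shear ρ) e
  rw [h1, LinearMap.det_comp] at h2
  have h3 : LinearMap.det (shear (-ρ)) * LinearMap.det (shear ρ) = 1 := by
    rw [← LinearMap.det_comp, shear_comp_shear, neg_add_cancel]
    have : shear (0 : W →ₗ[ℝ] V) = LinearMap.id := by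
      ext p <;> simp [shear_apply]
    rw [this, LinearMap.det_id]
  exact mul_right_cancel₀ (right_ne_zero_of_mul_eq_one h3) (h2.trans (one_mul _).symm)

/-- The determinant of a block map in terms of the Schur complement. -/
lemma det_block {T : V × W →ₗ[ℝ] V × W} {α α' : V →ₗ[ℝ] V} {ρ : W →ₗ[ℝ] V} {γ : V →ₗ[ℝ] W}
    {δ : W →ₗ[ℝ] W} (hT : ∀ x y, T (x, y) = (α x + ρ y, γ x + δ y)) (hα : ∀ x, α (α' x) = x)
    (hα' : ∀ x, α' (α x) = x) :
    LinearMap.det T = LinearMap.det α * LinearMap.det (δ - γ ∘ₗ α' ∘ₗ ρ) := by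
  let s : (V × W) ≃ₗ[ℝ] W × V := LinearEquiv.prodComm ℝ V W
  -- Block LDU factorisation; the lower triangular factor is a shear conjugated by swapping the two
  -- summands.
  have hfac : T = ((s.symm : _ →ₗ[ℝ] _) ∘ₗ shear (γ ∘ₗ α') ∘ₗ (s.symm.symm : _ →ₗ[ℝ] _)) ∘ₗ
      LinearMap.prodMap α (δ - γ ∘ₗ α' ∘ₗ ρ) ∘ₗ shear (α' ∘ₗ ρ) := by
    refine LinearMap.ext fun ⟨x, y⟩ => ?_
    rw [hT]
    refine Prod.ext ?_ ?_
    · change α x + ρ y = α (x + α' (ρ y))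
      rw [map_add, hα]
    · change γ x + δ y = δ y - γ (α' (ρ y)) + γ (α' (α (x + α' (ρ y))))
      rw [hα', map_add]
      abel
  rw [hfac, LinearMap.det_comp, LinearMap.det_conj, LinearMap.det_comp, det_shear, det_shear,
    LinearMap.det_prodMap, one_mul, mul_one]

end BlockDeterminant

/-! ### The real Jacobian as a function of the Dieudonné determinant. -/

section DieudonneJacobian

variable {F : Type} [NormedDivisionRing F] [StarRing F] [InnerProductSpace ℝ F]
  [FiniteDimensional ℝ F] [SMulCommClass ℝ F F] [CStarRing F] [StarMulSelf F]
  [IsScalarTower ℝ F F] [StarModule ℝ F]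

variable {n : ℕ}

variable (F) in
/-- The factor by which left multiplication by a scalar multiplies volumes. -/
def scalarJac : F →* ℝ where
  toFun a := |LinearMap.det (LinearMap.mulLeft ℝ a)|
  map_one' := by
    rw [LinearMap.mulLeft_one, LinearMap.det_id, abs_one]
  map_mul' a b := by
    rw [LinearMap.mulLeft_mul, LinearMap.det_comp, abs_mul]

variable (F) in
/-- The extension of `scalarJac` to the values of the Dieudonné determinant. -/
def classJac : WithZero (Abelianization Fˣ) →*₀ ℝ :=
  WithZero.lift' ((Units.coeHom ℝ).comp (Abelianization.lift (Units.map (scalarJac F))))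

lemma classJac_dieudonneClass {a : F} (ha : a ≠ 0) :
    classJac F (dieudonneClass a) = scalarJac F a := by
  rw [dieudonneClass, dif_neg ha]
  rfl

lemma scalarJac_neg_one_pow (k : ℕ) : scalarJac F ((-1) ^ k) = 1 := by
  have h : scalarJac F (-1) * scalarJac F (-1) = 1 := by
    rw [← map_mul, neg_mul_neg, one_mul, map_one]
  have h0 : 0 ≤ scalarJac F (-1) := abs_nonneg _
  have h1 : scalarJac F (-1) = 1 := by nlinarith
  rw [map_pow, h1, one_pow]

variable (F) in
/-- Splitting off the `i`-th coordinate. -/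
def splitCoord (i : Fin (n + 1)) : FVec F (n + 1) ≃ₗ[ℝ] F × FVec F n where
  toFun x := (x i, WithLp.toLp 2 fun r => x (i.succAbove r))
  map_add' _ _ := rfl
  map_smul' _ _ := rfl
  invFun p := WithLp.toLp 2 (i.insertNth (α := fun _ => F) p.1 p.2.ofLp)
  left_inv x := by
    ext j
    refine Fin.succAboveCases i ?_ (fun r => ?_) j <;> simp
  right_inv p := by
    refine Prod.ext ?_ ?_
    · simp
    · ext r
      simp

lemma norm_sq_splitCoord (i : Fin (n + 1)) (x : FVec F (n + 1)) :
    ‖x‖ ^ 2 = ‖(splitCoord F i x).1‖ ^ 2 + ‖(splitCoord F i x).2‖ ^ 2 := by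
  rw [PiLp.norm_sq_eq_of_L2, PiLp.norm_sq_eq_of_L2, Fin.sum_univ_succAbove _ i]
  rfl

/-- The composite only permutes coordinates, hence is an isometry. -/
lemma abs_det_splitCoord (i j : Fin (n + 1)) :
    |LinearMap.det ((splitCoord F j).symm.toLinearMap ∘ₗ (splitCoord F i).toLinearMap)| = 1 := by
  let φ : FVec F (n + 1) →ₗᵢ[ℝ] FVec F (n + 1) :=
    { toLinearMap := (splitCoord F j).symm.toLinearMap ∘ₗ (splitCoord F i).toLinearMap
      norm_map' := fun x => by
        rw [← sq_eq_sq₀ (norm_nonneg _) (norm_nonneg _), norm_sq_splitCoord j,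
          norm_sq_splitCoord i x]
        simp }
  have h := φ.normDet_eq_one
  rw [LinearMap.normDet_eq_norm_det] at h
  exact h

/-- One elimination step of `dieudonneDet`, seen by real volumes: the Schur complement formula with
the pivot `A i 0` as upper left block. -/
lemma jac_eq_mul_schur (A : Matrix (Fin (n + 1)) (Fin (n + 1)) F) (i : Fin (n + 1))
    (hi : A i 0 ≠ 0) :
    jac A = scalarJac F (A i 0) * jac (Matrix.of fun (r c : Fin n) => A (i.succAbove r) c.succ
      - A (i.succAbove r) 0 * (A i 0)⁻¹ * A i c.succ) := by
  let e := splitCoord F i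
  let e₀ := splitCoord F (0 : Fin (n + 1))
  let T : F × FVec F n →ₗ[ℝ] F × FVec F n :=
    e.toLinearMap ∘ₗ realAct A ∘ₗ e₀.symm.toLinearMap
  -- The source splits off coordinate `0` and the target coordinate `i`, so `T` is not a conjugate
  -- of `A`; the correction has determinant `±1`.
  have hT : LinearMap.det (realAct A) * LinearMap.det (e₀.symm.toLinearMap ∘ₗ e.toLinearMap)
      = LinearMap.det T := by
    rw [mul_comm, ← LinearMap.det_comp, ← LinearMap.det_conj T e₀.symm]
    congr 1
    ext1 x
    simp [T]
  let ρ : FVec F n →ₗ[ℝ] F :=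
    { toFun := fun y => ∑ c, A i c.succ * y c
      map_add' := fun x y => by simp [mul_add, Finset.sum_add_distrib]
      map_smul' := fun r x => by
        rw [RingHom.id_apply, Finset.smul_sum]
        exact Finset.sum_congr rfl fun c _ => mul_smul_comm r (A i c.succ) (x c) }
  let γ : F →ₗ[ℝ] FVec F n :=
    { toFun := fun x => WithLp.toLp 2 fun r => A (i.succAbove r) 0 * x
      map_add' := fun x y => by
        ext r
        simp [mul_add]
      map_smul' := fun r x => by
        ext j
        exact mul_smul_comm r (A (i.succAbove j) 0) x }
  let D : Matrix (Fin n) (Fin n) F := Matrix.of fun r c => A (i.succAbove r) c.succ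
  have hblock : ∀ x y, T (x, y)
      = (LinearMap.mulLeft ℝ (A i 0) x + ρ y, γ x + realAct D y) := by
    intro x y
    have hx : ∀ j, realAct A (e₀.symm (x, y)) j = A j 0 * x + ∑ c : Fin n, A j c.succ * y c := by
      intro j
      rw [realAct_apply, Fin.sum_univ_succ]
      congr 1
    refine Prod.ext (hx i) ?_
    ext r
    exact hx (i.succAbove r)
  have h := det_block hblock (α' := LinearMap.mulLeft ℝ (A i 0)⁻¹)
    (fun x => by simp [hi]) (fun x => by simp [hi])
  have hS : realAct D - γ ∘ₗ LinearMap.mulLeft ℝ (A i 0)⁻¹ ∘ₗ ρ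
      = realAct (Matrix.of fun (r c : Fin n) => A (i.succAbove r) c.succ
      - A (i.succAbove r) 0 * (A i 0)⁻¹ * A i c.succ) := by
    ext y r
    change ∑ c, D r c * y c - A (i.succAbove r) 0 * ((A i 0)⁻¹ * ∑ c, A i c.succ * y c)
      = ∑ c, (A (i.succAbove r) c.succ - A (i.succAbove r) 0 * (A i 0)⁻¹ * A i c.succ) * y c
    simp only [D, Matrix.of_apply, sub_mul, Finset.sum_sub_distrib, Finset.mul_sum, mul_assoc]
  rw [hS, ← hT] at h
  have h' := congrArg abs h
  rw [abs_mul, abs_mul, abs_det_splitCoord, mul_one, ← jac_eq_abs_det, ← jac_eq_abs_det] at h'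
  exact h'

/-- The real Jacobian of a matrix only depends on its Dieudonné determinant. -/
theorem jac_eq_classJac_dieudonneDet (A : Matrix (Fin n) (Fin n) F) :
    jac A = classJac F (dieudonneDet n A) := by
  induction n with
  | zero =>
    rw [dieudonneDet, map_one]
    have : A = 1 := Subsingleton.elim _ _
    rw [this, jac_one]
  | succ n ih =>
    rw [dieudonneDet]
    split_ifs with h
    · have hi := h.choose_spec
      rw [jac_eq_mul_schur A h.choose hi, ih, map_mul, classJac_dieudonneClass
        (mul_ne_zero (pow_ne_zero _ (neg_ne_zero.mpr one_ne_zero)) hi), map_mul,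
        scalarJac_neg_one_pow, one_mul]
    · rw [map_zero]
      -- A zero first column means that the first basis vector is killed, which contradicts
      -- injectivity.
      by_contra hA
      push Not at h
      have hinj := jac_ne_zero_iff.mp hA
      have h0 : realAct A (WithLp.toLp 2 (Pi.single 0 1)) = 0 := by
        ext j
        rw [realAct_single, h]
        rfl
      have h1 := hinj (h0.trans (map_zero _).symm)
      have h2 := congrArg (fun x : FVec F (n + 1) => x 0) h1
      simp at h2

lemma jac_eq_one_of_dieudonneDet {A : Matrix (Fin n) (Fin n) F} (hA : dieudonneDet n A = 1) :
    jac A = 1 := by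
  rw [jac_eq_classJac_dieudonneDet, hA, map_one]

end DieudonneJacobian

lemma dieudonneDet_eq_one_of_det {k : Type} [Field k] {n : ℕ} {A : Matrix (Fin n) (Fin n) k}
    (hA : A.det = 1) : dieudonneDet n A = 1 := by
  rw [dieudonneDet_eq_det, hA, dieudonneClass, dif_neg one_ne_zero, Units.mk0_one, map_one,
    WithZero.coe_one]

lemma secondCountableTopology_clm {V : Type*} [NormedAddCommGroup V] [InnerProductSpace ℝ V]
    [FiniteDimensional ℝ V] : SecondCountableTopology (V →L[ℝ] V) := by
  have : ProperSpace (V →L[ℝ] V) := FiniteDimensional.proper_real _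
  infer_instance

/-! ### Lebesgue measure of subspaces in isometric coordinates. -/

/-- The Lebesgue measure of a euclidean space with its Borel σ-algebra. -/
def euclideanVolume (V : Type) [NormedAddCommGroup V] [InnerProductSpace ℝ V]
    [FiniteDimensional ℝ V] : @Measure V (borel V) :=
  letI : MeasurableSpace V := borel V
  haveI : BorelSpace V := ⟨rfl⟩
  (measureSpaceOfInnerProductSpace (E := V)).volume

lemma subspaceVolume_eq_preimage {V' V : Type} [NormedAddCommGroup V'] [InnerProductSpace ℝ V']
    [FiniteDimensional ℝ V'] [NormedAddCommGroup V] [InnerProductSpace ℝ V]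
    [FiniteDimensional ℝ V] {W : Submodule ℝ V} (φ : V' ≃ₗᵢ[ℝ] W) (S : Set W) :
    subspaceVolume W S = euclideanVolume V' (φ ⁻¹' S) := by
  let _ : MeasurableSpace V' := borel V'
  have : BorelSpace V' := ⟨rfl⟩
  let _ : MeasurableSpace W := borel W
  have : BorelSpace W := ⟨rfl⟩
  exact (φ.measurePreserving.measure_preimage_equiv (f := φ.toHomeomorph.toMeasurableEquiv) S).symm

/-- The hypothesis makes `T` the adjoint of `φ` viewed as a map into `V`, and the orthogonal
projection onto the range of an isometry is `φ` composed with that adjoint. -/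
lemma preimage_orthogonalProjection_image {V' V : Type} [NormedAddCommGroup V']
    [InnerProductSpace ℝ V'] [NormedAddCommGroup V] [InnerProductSpace ℝ V]
    [FiniteDimensional ℝ V] {W : Submodule ℝ V} (φ : V' ≃ₗᵢ[ℝ] W) {T : V →ₗ[ℝ] V'}
    (hT : ∀ c k, inner ℝ (φ c : V) k = inner ℝ c (T k)) (K : Set V) :
    φ ⁻¹' (W.orthogonalProjectionOnto '' K) = T '' K := by
  have hP : ∀ k : V, W.orthogonalProjectionOnto k = φ (T k) := by
    intro k
    rw [← φ.symm_apply_eq]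
    refine ext_inner_left ℝ fun c => ?_
    rw [← hT, ← φ.inner_map_map, φ.apply_symm_apply,
      Submodule.inner_orthogonalProjectionOnto_eq_of_mem_left]
  simp_rw [hP]
  rw [← Set.image_image φ T, Set.preimage_image_eq _ φ.injective]

section Volumes

variable {V : Type} [NormedAddCommGroup V] [InnerProductSpace ℝ V] [FiniteDimensional ℝ V]

lemma euclideanVolume_preimage {f : V →ₗ[ℝ] V} (hf : LinearMap.det f ≠ 0) (s : Set V) :
    euclideanVolume V (f ⁻¹' s) = (ENNReal.ofReal |LinearMap.det f|)⁻¹ * euclideanVolume V s := by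
  let _ : MeasurableSpace V := borel V
  have : BorelSpace V := ⟨rfl⟩
  rw [← ENNReal.ofReal_inv_of_pos (abs_pos.mpr hf), ← abs_inv]
  exact Measure.addHaar_preimage_linearMap volume hf s

lemma euclideanVolume_image (f : V →ₗ[ℝ] V) (s : Set V) :
    euclideanVolume V (f '' s) = ENNReal.ofReal |LinearMap.det f| * euclideanVolume V s := by
  let _ : MeasurableSpace V := borel V
  have : BorelSpace V := ⟨rfl⟩
  exact Measure.addHaar_image_linearMap volume f s

lemma measurable_euclideanVolume_section {α : Type*} [TopologicalSpace α] [MeasurableSpace α]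
    [BorelSpace α] [SecondCountableTopology α] {s : Set (α × V)} (hs : IsClosed s) :
    Measurable fun a => euclideanVolume V (Prod.mk a ⁻¹' s) := by
  let _ : MeasurableSpace V := borel V
  have : BorelSpace V := ⟨rfl⟩
  have : SFinite (euclideanVolume V) :=
    inferInstanceAs (SFinite (measureSpaceOfInnerProductSpace (E := V)).volume)
  exact measurable_measure_prodMk_left hs.measurableSet

end Volumes

/-! ### Quermassintegrals as integrals of densities, and their invariance. -/

section Quermassintegrals

attribute [local instance] matrixMeasurableSpace matrixBorelSpace

variable {F : Type} [NormedDivisionRing F] [StarRing F] [InnerProductSpace ℝ F]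
  [FiniteDimensional ℝ F] [SMulCommClass ℝ F F] [CStarRing F] [StarMulSelf F]
  [IsScalarTower ℝ F F] [StarModule ℝ F]

variable {n m : ℕ}

/-- The volume of `X⁻¹ K`, to the power `n`. -/
def sectionDensity (K : Set (FVec F n)) (X : Matrix (Fin n) (Fin m) F) : ℝ≥0∞ :=
  euclideanVolume (FVec F m) (realAct X ⁻¹' K) ^ n

/-- The volume of `X* K`, to the power `-n`. -/
def projDensity (K : Set (FVec F n)) (X : Matrix (Fin n) (Fin m) F) : ℝ≥0∞ :=
  (euclideanVolume (FVec F m) (realAct X.conjTranspose '' K) ^ n)⁻¹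

lemma isDensity_sectionDensity {K : Set (FVec F n)} (hK : IsClosed K) :
    IsDensity (sectionDensity K : Matrix (Fin n) (Fin m) F → ℝ≥0∞) where
  measurable :=
    (measurable_euclideanVolume_section (hK.preimage continuous_realAct_prod)).pow_const n
  mul_right X A _ hA := by
    have hdet : LinearMap.det (realAct A) ≠ 0 := by
      rwa [← abs_ne_zero, ← jac_eq_abs_det]
    rw [sectionDensity, sectionDensity, realAct_mul, LinearMap.coe_comp, Set.preimage_comp,
      euclideanVolume_preimage hdet, ← jac_eq_abs_det, mul_pow, ENNReal.inv_pow]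
    rfl

lemma isDensity_projDensity {K : Set (FVec F n)} (hK : IsCompact K) :
    IsDensity (projDensity K : Matrix (Fin n) (Fin m) F → ℝ≥0∞) where
  measurable := by
    have : CompactSpace K := isCompact_iff_compactSpace.mp hK
    let T : Set ((Matrix (Fin n) (Fin m) F × FVec F m) × K) :=
      {q | realAct q.1.1.conjTranspose q.2 = q.1.2}
    have hT : IsClosed T := by
      refine isClosed_eq (continuous_realAct_prod.comp ((continuous_fst.comp
        continuous_fst).matrix_conjTranspose.prodMk (continuous_subtype_val.comp continuous_snd)))
        (continuous_snd.comp continuous_fst)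
    -- The pairs `(X, y)` with `y ∈ X*K` form a closed set, being the projection of a closed set
    -- along the compact factor `K`.
    have hS : IsClosed (Prod.fst '' T) := isClosedMap_fst_of_compactSpace _ hT
    have h := measurable_euclideanVolume_section hS
    have heq : ∀ X : Matrix (Fin n) (Fin m) F,
        Prod.mk X ⁻¹' (Prod.fst '' T) = realAct X.conjTranspose '' K := by
      intro X
      ext y
      constructor
      · rintro ⟨⟨⟨X', y'⟩, k⟩, hq, hX⟩
        obtain ⟨rfl, rfl⟩ := Prod.mk.inj hX
        exact ⟨k, k.2, hq⟩
      · rintro ⟨k, hk, rfl⟩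
        exact ⟨((X, realAct X.conjTranspose k), ⟨k, hk⟩), rfl, rfl⟩
    simp_rw [heq] at h
    exact (h.pow_const n).inv
  mul_right X A _ hA := by
    rw [projDensity, projDensity, Matrix.conjTranspose_mul, realAct_mul, LinearMap.coe_comp,
      Set.image_comp, euclideanVolume_image, ← jac_eq_abs_det, jac_conjTranspose, mul_pow]
    exact ENNReal.mul_inv (Or.inl (ejac_pow_ne_zero hA n)) (Or.inl (ejac_pow_ne_top A n))

/-! ### Sections and projections in coordinates -/

lemma realAct_coordIncl (x : FVec F m) (i : Fin n) :
    realAct (coordIncl F n m) x i = if hi : (i : ℕ) < m then x ⟨i, hi⟩ else 0 := by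
  rw [realAct_apply]
  split_ifs with hi
  · rw [Finset.sum_eq_single ⟨i, hi⟩]
    · simp [coordIncl]
    · intro k _ hk
      have : (i : ℕ) ≠ k := fun h' => hk (Fin.ext h'.symm)
      simp [coordIncl, this]
    · simp
  · refine Finset.sum_eq_zero fun k _ => ?_
    have : (i : ℕ) ≠ k := fun h' => hi (h' ▸ k.2)
    simp [coordIncl, this]

lemma conjTranspose_mul_unitary_coordIncl (h : m ≤ n) (u : UnitaryGp F n) :
    (u.toMatrix * coordIncl F n m).conjTranspose * (u.toMatrix * coordIncl F n m) = 1 := by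
  rw [Matrix.conjTranspose_mul, Matrix.mul_assoc, ← Matrix.mul_assoc _ u.toMatrix,
    u.conjTranspose_mul_self, Matrix.one_mul, conjTranspose_coordIncl_mul h]

lemma realAct_unitary_coordIncl_mem (h : m ≤ n) (u : UnitaryGp F n) (x : FVec F m) :
    realAct (u.toMatrix * coordIncl F n m) x ∈ (Gr.rotate u (Gr.base F h)).real := by
  refine ⟨realAct (coordIncl F n m) x, fun i hi => ?_, ?_⟩
  · rw [realAct_coordIncl, dif_neg (not_lt.mpr hi)]
  · rw [realAct_mul]
    rfl

/-- The isometry of `F^m` onto the rotated base point of the Grassmannian. -/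
def frameIsometry (h : m ≤ n) (u : UnitaryGp F n) :
    FVec F m ≃ₗᵢ[ℝ] (Gr.rotate u (Gr.base F h)).real :=
  LinearIsometryEquiv.ofSurjective
    { toLinearMap := (realAct (u.toMatrix * coordIncl F n m)).codRestrict _
        (realAct_unitary_coordIncl_mem h u)
      norm_map' := fun x =>
        norm_realAct_of_isometry (conjTranspose_mul_unitary_coordIncl h u) x } (by
    rintro ⟨_, y, hy, rfl⟩
    refine ⟨WithLp.toLp 2 fun i => y (Fin.castLE h i), Subtype.ext ?_⟩
    have hy' : realAct (coordIncl F n m) (WithLp.toLp 2 fun i => y (Fin.castLE h i)) = y := by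
      ext i
      rw [realAct_coordIncl]
      split_ifs with hi
      · rfl
      · exact (hy i (not_lt.mp hi)).symm
    change realAct (u.toMatrix * coordIncl F n m) _ = matrixAct u.toMatrix y
    rw [realAct_mul, LinearMap.comp_apply, hy']
    rfl)

lemma coe_frameIsometry (h : m ≤ n) (u : UnitaryGp F n) (x : FVec F m) :
    (frameIsometry h u x : FVec F n) = realAct (u.toMatrix * coordIncl F n m) x := rfl

lemma sectionVolume_rotate (h : m ≤ n) (K : Set (FVec F n)) (u : UnitaryGp F n) :
    sectionVolume K (Gr.rotate u (Gr.base F h)) ^ n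
      = sectionDensity K (u.toMatrix * coordIncl F n m) := by
  rw [sectionVolume, subspaceVolume_eq_preimage (frameIsometry h u)]
  rfl

lemma projVolume_rotate (h : m ≤ n) (K : Set (FVec F n)) (u : UnitaryGp F n) :
    (projVolume K (Gr.rotate u (Gr.base F h)) ^ n)⁻¹
      = projDensity K (u.toMatrix * coordIncl F n m) := by
  rw [projVolume, subspaceVolume_eq_preimage (frameIsometry h u), projDensity,
    preimage_orthogonalProjection_image (frameIsometry h u) fun c k => ?_]
  rw [coe_frameIsometry, inner_realAct]

/-! ### Integration over the Grassmannian -/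

instance : T0Space (Gr F n m) := by
  have hinj : Function.Injective fun E : Gr F n m => E.real.starProjection := by
    intro E E' hE
    have h : E.real = E'.real := Submodule.starProjection_inj.mp hE
    exact Subtype.ext (Submodule.restrictScalars_injective ℝ _ _ h)
  exact (Topology.IsEmbedding.mk ⟨rfl⟩ hinj).t0Space

instance : SecondCountableTopology (Gr F n m) :=
  have := secondCountableTopology_clm (V := FVec F n)
  Topology.IsInducing.secondCountableTopology
    (f := fun E : Gr F n m => E.real.starProjection) ⟨rfl⟩

instance : PolishSpace (UnitaryGp F n) := by
  have : ProperSpace F := FiniteDimensional.proper_real F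
  have : PolishSpace (Matrix (Fin n) (Fin n) F) := inferInstanceAs (PolishSpace (Fin n → Fin n → F))
  exact IsClosed.polishSpace (isClosed_unitary (R := Matrix (Fin n) (Fin n) F))

/-- The orbit map is a continuous surjection from a Polish space onto a second countable T0 space,
so a subset of the Grassmannian with Borel preimage is Borel. Measurability of the volume functions
can thus be tested on the unitary group. -/
lemma measurable_of_measurable_rotate (h : m ≤ n) {f : Gr F n m → ℝ≥0∞}
    (hf : Measurable fun u : UnitaryGp F n => f (Gr.rotate u (Gr.base F h))) : Measurable f := by
  have hmap := Continuous.map_borel_eq (Gr.continuous_rotate (Gr.base F h))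
    (exists_rotate_base_eq h)
  intro s hs
  change MeasurableSet[borel (Gr F n m)] (f ⁻¹' s)
  rw [← hmap]
  exact hf hs

lemma lintegral_haar_eq (h : m ≤ n) {f : Gr F n m → ℝ≥0∞}
    {φ : Matrix (Fin n) (Fin m) F → ℝ≥0∞} (hφ : Measurable φ)
    (hf : ∀ u, f (Gr.rotate u (Gr.base F h)) = φ (u.toMatrix * coordIncl F n m)) :
    ∫⁻ E, f E ∂(Gr.haar F h)
      = ∫⁻ u : UnitaryGp F n, φ (u.toMatrix * coordIncl F n m) ∂(unitaryHaar F n) := by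
  have hm : Measurable fun u : UnitaryGp F n => f (Gr.rotate u (Gr.base F h)) := by
    simp_rw [hf]
    exact hφ.comp (UnitaryGp.continuous_toMatrix.matrix_mul continuous_const).measurable
  rw [Gr.haar, lintegral_map (measurable_of_measurable_rotate h hm)
    (Gr.continuous_rotate _).measurable]
  simp_rw [hf]

lemma continuous_matrixAct_right (g : Matrix (Fin n) (Fin n) F) : Continuous (matrixAct g) :=
  (realAct g).continuous_of_finiteDimensional

/-- Affine quermassintegrals are invariant under volume preserving `F`-linear maps. -/
theorem affineQuermassintegral_image (h : m ≤ n) {K : Set (FVec F n)} (hK : IsCompact K)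
    {g : Matrix (Fin n) (Fin n) F} (hg : jac g = 1) :
    affineQuermassintegral h (matrixAct g '' K) = affineQuermassintegral h K := by
  have hgK := hK.image (continuous_matrixAct_right g)
  -- `X*(gK) = (g*X)*K`, and `g*` has the same Jacobian as `g`.
  have heq : ∀ X : Matrix (Fin n) (Fin m) F,
      projDensity (matrixAct g '' K) X = projDensity K (g.conjTranspose * X) := by
    intro X
    rw [projDensity, projDensity, Matrix.conjTranspose_mul, Matrix.conjTranspose_conjTranspose,
      realAct_mul, LinearMap.coe_comp, Set.image_comp]
    rfl
  rw [affineQuermassintegral, affineQuermassintegral,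
    lintegral_haar_eq h (isDensity_projDensity hgK).measurable (projVolume_rotate h _),
    lintegral_haar_eq h (isDensity_projDensity hK).measurable (projVolume_rotate h _)]
  simp_rw [heq]
  exact lintegral_unitary_comp_mul_left h (isDensity_projDensity hK)
    (by rw [jac_conjTranspose, hg])

/-- Dual affine quermassintegrals are invariant under volume preserving `F`-linear maps. -/
theorem dualAffineQuermassintegral_image (h : m ≤ n) {K : Set (FVec F n)} (hK : IsCompact K)
    {g : Matrix (Fin n) (Fin n) F} (hg : jac g = 1) :
    dualAffineQuermassintegral h (matrixAct g '' K) = dualAffineQuermassintegral h K := by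
  have hgK := hK.image (continuous_matrixAct_right g)
  obtain ⟨g', hgg', hg'g⟩ := exists_inverse_of_jac_ne_zero (hg.trans_ne one_ne_zero)
  have hg' : jac g' = 1 := by
    have := jac_mul_jac g g'
    rwa [hgg', jac_one, hg, one_mul, eq_comm] at this
  -- `X⁻¹(gK) = (g⁻¹X)⁻¹K` as preimages, with `g'` the inverse of `g`.
  have heq : ∀ X : Matrix (Fin n) (Fin m) F,
      sectionDensity (matrixAct g '' K) X = sectionDensity K (g' * X) := by
    intro X
    have himage : matrixAct g '' K = matrixAct g' ⁻¹' K := by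
      refine congrFun (Set.image_eq_preimage_of_inverse (fun x => ?_) (fun x => ?_)) K
      · rw [← matrixAct_mul, hg'g, matrixAct_one]
      · rw [← matrixAct_mul, hgg', matrixAct_one]
    rw [sectionDensity, sectionDensity, realAct_mul, LinearMap.coe_comp, Set.preimage_comp, himage]
    rfl
  rw [dualAffineQuermassintegral, dualAffineQuermassintegral,
    lintegral_haar_eq h (isDensity_sectionDensity hgK.isClosed).measurable
      (sectionVolume_rotate h _),
    lintegral_haar_eq h (isDensity_sectionDensity hK.isClosed).measurable
      (sectionVolume_rotate h _)]
  simp_rw [heq]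
  exact lintegral_unitary_comp_mul_left h (isDensity_sectionDensity hK.isClosed) hg'

end Quermassintegrals

instance : StarModule ℝ ℍ[ℝ] := ⟨fun r x => by simp⟩

end

theorem theorem6p1 (m n : ℕ) (hm : 1 ≤ m) (hmn : m ≤ n) :
    (∀ K : ConvexBody (FVec ℝ n), (interior (K : Set (FVec ℝ n))).Nonempty →
      ∀ g : Matrix.SpecialLinearGroup (Fin n) ℝ,
        affineQuermassintegral hmn (matrixAct (g : Matrix (Fin n) (Fin n) ℝ) '' (K :
            Set (FVec ℝ n)))
          = affineQuermassintegral hmn (K : Set (FVec ℝ n)) ∧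
        dualAffineQuermassintegral hmn
            (matrixAct (g : Matrix (Fin n) (Fin n) ℝ) '' (K : Set (FVec ℝ n)))
          = dualAffineQuermassintegral hmn (K : Set (FVec ℝ n))) ∧
    (∀ K : ConvexBody (FVec ℂ n), (interior (K : Set (FVec ℂ n))).Nonempty →
      ∀ g : Matrix.SpecialLinearGroup (Fin n) ℂ,
        affineQuermassintegral hmn (matrixAct (g : Matrix (Fin n) (Fin n) ℂ) '' (K :
            Set (FVec ℂ n)))
          = affineQuermassintegral hmn (K : Set (FVec ℂ n)) ∧
        dualAffineQuermassintegral hmn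
            (matrixAct (g : Matrix (Fin n) (Fin n) ℂ) '' (K : Set (FVec ℂ n)))
          = dualAffineQuermassintegral hmn (K : Set (FVec ℂ n))) ∧
    (∀ K : ConvexBody (FVec ℍ[ℝ] n), (interior (K : Set (FVec ℍ[ℝ] n))).Nonempty →
      ∀ g : Matrix (Fin n) (Fin n) ℍ[ℝ], g ∈ quaternionicSL n →
        affineQuermassintegral hmn (matrixAct g '' (K : Set (FVec ℍ[ℝ] n)))
          = affineQuermassintegral hmn (K : Set (FVec ℍ[ℝ] n)) ∧
        dualAffineQuermassintegral hmn (matrixAct g '' (K : Set (FVec ℍ[ℝ] n)))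
          = dualAffineQuermassintegral hmn (K : Set (FVec ℍ[ℝ] n))) := by
  refine ⟨fun K _ g => ?_, fun K _ g => ?_, fun K _ g hg => ?_⟩
  · have hg := jac_eq_one_of_dieudonneDet (dieudonneDet_eq_one_of_det g.2)
    exact ⟨affineQuermassintegral_image hmn K.isCompact hg,
      dualAffineQuermassintegral_image hmn K.isCompact hg⟩
  · have hg := jac_eq_one_of_dieudonneDet (dieudonneDet_eq_one_of_det g.2)
    exact ⟨affineQuermassintegral_image hmn K.isCompact hg,
      dualAffineQuermassintegral_image hmn K.isCompact hg⟩
  · have hg' := jac_eq_one_of_dieudonneDet hg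
    exact ⟨affineQuermassintegral_image hmn K.isCompact hg',
      dualAffineQuermassintegral_image hmn K.isCompact hg'⟩
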